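/- Let $L:\mathbb R^d\to\mathbb R$ be of class $C^2$ with $L_m:=\min_{\mathbb R^d}L>0$ and $C_L:=\sup_{x}\|\nabla^2L(x)\|_2<\infty$ (spectral norm), and let $X_*$ be the unique global minimizer of $L$, with $\det\nabla^2L(X_*)>0$. Let $X_{in}$ be an $\mathbb R^d$-valued random variable whose law has a density $f$ with respect to Lebesgue measure, where $f$ is compactly supported, continuous at $X_*$, and $f(X_*)>0$. Let $0<\varepsilon<1$. Then there is a function $E$, depending only on $L$, the law of $X_{in}$ and $\varepsilon$, such that $E(\beta)=O(1/\beta)$ as $\beta\to\infty$, $$-\frac1\beta\log\mathbb E e^{-\beta L(X_{in})}-\frac1\beta\log\varepsilon=L(X_*)+\frac d2\,\frac{\log\beta}{\beta}+E(\beta)\qquad(\beta>0),$$ and the following holds for all $\beta>0$, all integers $N\ge1$ and all real $\gamma,\zeta$ with $(\gamma-1)^2+\zeta^2<1$. On a probability space, let $X_0^1,\dots,X_0^N$ be i.i.d. with the law of $X_{in}$, let $\eta_n^l$ ($n\ge0$, $1\le l\le d$) be i.i.d. real random variables with $\mathbb E[\eta_n^l]=0$ and $\mathbb E|\eta_n^l|^2=\zeta^2$,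 let the families $(X_0^i)_i$ and $(\eta_n^l)_{n,l}$ be independent of each other, and let $X_n^i=(x_n^{i,1},\dots,x_n^{i,d})$ solve, almost surely, $$X_{n+1}^i=X_n^i-\gamma(X_n^i-\bar X_n^*)-\sum_{l=1}^d(x_n^{i,l}-\bar x_n^{*,l})\,\eta_n^l\,e_l,\qquad \bar X_n^*=(\bar x_n^{*,1},\dots,\bar x_n^{*,d})=\frac{\sum_{j=1}^N X_n^je^{-\beta L(X_n^j)}}{\sum_{j=1}^N e^{-\beta L(X_n^j)}},$$ for $n\ge0$ and $1\le i\le N$, where $e_1,\dots,e_d$ is the standard basis of $\mathbb R^d$. Put $\bar x_0^l:=\frac1N\sum_{i=1}^N x_0^{i,l}$ and assume $$(1-\varepsilon)\,\mathbb E\big[e^{-\beta L(X_{in})}\big]\ \ge\ \frac{2C_L\sqrt{\big(1+(1-\gamma)^2+\zeta^2\big)\big(\gamma^2+\zeta^2\big)}\;\beta e^{-\beta L_m}}{1-e^{-[1-(\gamma-1)^2-\zeta^2]}}\ \sum_{l=1}^d\mathbb E\max_{1\le i\le N}(x_0^{i,l}-\bar x_0^l)^2 .$$ Then there is a random variable $X_\infty$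 with $\lim_{n\to\infty}X_n^i=X_\infty$ almost surely for every $i$, and $$\operatorname*{ess\,inf}_{\omega}L(X_\infty)\le-\frac1\beta\log\mathbb E e^{-\beta L(X_{in})}-\frac1\beta\log\varepsilon ,\qquad \Big|\operatorname*{ess\,inf}_{\omega}L(X_\infty)-L(X_*)\Big|\le\frac d2\,\frac{\log\beta}{\beta}+E(\beta).$$ -/

import Mathlib

open MeasureTheory ProbabilityTheory Filter Topology Asymptotics

noncomputable section

namespace CBO

/-- The search space `ℝ^d` with the Euclidean norm. -/
abbrev Space (d : ℕ) : Type := EuclideanSpace ℝ (Fin d)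

/-- The Hessian matrix `∇²L(x)`, whose `(i, j)` entry is `∂ᵢ∂ⱼ L(x)`. -/
def hessian {d : ℕ} (L : Space d → ℝ) (x : Space d) : Matrix (Fin d) (Fin d) ℝ :=
  Matrix.of fun i j =>
    fderiv ℝ (fun y => fderiv ℝ L y (EuclideanSpace.single j 1)) x (EuclideanSpace.single i 1)

/-- The spectral norm of a square matrix (operator norm on Euclidean space). -/
def spectralNorm {d : ℕ} (A : Matrix (Fin d) (Fin d) ℝ) : ℝ :=
  ‖Matrix.toEuclideanCLM (n := Fin d) (𝕜 := ℝ) A‖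

/-- `L_m`, the minimal value of `L`. -/
def minValue {d : ℕ} (L : Space d → ℝ) : ℝ := ⨅ x, L x

/-- `C_L = sup_x ‖∇²L(x)‖₂`. -/
def hessianBound {d : ℕ} (L : Space d → ℝ) : ℝ := ⨆ x, spectralNorm (hessian L x)

/-- `L` is `C²` with positive minimum and bounded Hessian, and `Xstar` is its unique global
minimizer, at which the Hessian has positive determinant. -/
structure Objective {d : ℕ} (L : Space d → ℝ) (Xstar : Space d) : Prop where
  contDiff : ContDiff ℝ 2 L
  min_pos : 0 < minValue L
  hessian_bdd : BddAbove (Set.range fun x => spectralNorm (hessian L x))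
  unique_min : ∀ x, x ≠ Xstar → L Xstar < L x
  det_pos : 0 < (hessian L Xstar).det

/-- The random variable `Xin` has the probability density `f` with respect to Lebesgue measure;
`f` is compactly supported, continuous at `Xstar`, and positive there. -/
structure ReferenceLaw {d : ℕ} {Ω₀ : Type*} [MeasurableSpace Ω₀] (P₀ : Measure Ω₀)
    (Xin : Ω₀ → Space d) (f : Space d → ℝ) (Xstar : Space d) : Prop where
  measurable_var : Measurable Xin
  measurable_density : Measurable f
  density_nonneg : ∀ x, 0 ≤ f x
  law_eq : P₀.map Xin = volume.withDensity fun x => ENNReal.ofReal (f x)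
  compactSupport : HasCompactSupport f
  continuousAt : ContinuousAt f Xstar
  pos : 0 < f Xstar

/-- The weighted average `(∑ⱼ xⱼ exp (-β L(xⱼ))) / ∑ⱼ exp (-β L(xⱼ))`. -/
def weightedMean {d N : ℕ} (β : ℝ) (L : Space d → ℝ) (x : Fin N → Space d) : Space d :=
  (∑ j, Real.exp (-β * L (x j)))⁻¹ • ∑ j, Real.exp (-β * L (x j)) • x j

/-- The ensemble average `(1/N) ∑ⱼ xⱼ`. -/
def ensembleMean {d N : ℕ} (x : Fin N → Space d) : Space d := (N : ℝ)⁻¹ • ∑ j, x j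

/-- The noise variables `η n l` are i.i.d., square integrable, centred, with variance `ζ²`. -/
structure Noise {d : ℕ} {Ω : Type*} [MeasurableSpace Ω] (P : Measure Ω) (ζ : ℝ)
    (η : ℕ → Fin d → Ω → ℝ) : Prop where
  measurable : ∀ n l, Measurable (η n l)
  indep : iIndepFun (fun p : ℕ × Fin d => η p.1 p.2) P
  ident : ∀ n l n' l', IdentDistrib (η n l) (η n' l') P P
  memLp : ∀ n l, MemLp (η n l) 2 P
  mean : ∀ n l, ∫ ω, η n l ω ∂P = 0
  variance : ∀ n l, ∫ ω, (η n l ω) ^ 2 ∂P = ζ ^ 2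

/-- The initial positions are i.i.d. with the law of `Xin`, and are independent of the noise. -/
structure InitialData {d N : ℕ} {Ω Ω₀ : Type*} [MeasurableSpace Ω] [MeasurableSpace Ω₀]
    (P : Measure Ω) (P₀ : Measure Ω₀) (Xin : Ω₀ → Space d) (η : ℕ → Fin d → Ω → ℝ)
    (X0 : Fin N → Ω → Space d) : Prop where
  measurable : ∀ i, Measurable (X0 i)
  indep : iIndepFun X0 P
  ident : ∀ i, IdentDistrib (X0 i) Xin P P₀
  indep_noise :
    IndepFun (fun ω (i : Fin N) => X0 i ω) (fun ω (p : ℕ × Fin d) => η p.1 p.2 ω) P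

/-- The process `X n i` (time `n`, particle `i`) solves the discrete consensus-based
optimization scheme, almost surely. -/
def IsSolution {d N : ℕ} {Ω : Type*} [MeasurableSpace Ω] (P : Measure Ω) (L : Space d → ℝ)
    (β γ : ℝ) (η : ℕ → Fin d → Ω → ℝ) (X : ℕ → Fin N → Ω → Space d) : Prop :=
  ∀ᵐ ω ∂P, ∀ n i,
    X (n + 1) i ω =
      X n i ω - γ • (X n i ω - weightedMean β L (fun j => X n j ω))
        - ∑ l, ((X n i ω l - weightedMean β L (fun j => X n j ω) l) * η n l ω) •
            (EuclideanSpace.single l 1 : Space d)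

/-- The initial spread `∑_l E max_i (x₀^{i,l} - x̄₀^l)²`. -/
def initialSpread {d N : ℕ} {Ω : Type*} [MeasurableSpace Ω] (P : Measure Ω)
    (X0 : Fin N → Ω → Space d) : ℝ :=
  ∑ l : Fin d, ∫ ω, ⨆ i, (X0 i ω l - ensembleMean (fun j => X0 j ω) l) ^ 2 ∂P

end CBO

end

/-! The noise is shared by all particles, so subtracting two copies of the scheme cancels both the
consensus point and its noise: in each coordinate, differences are multiplied by `1 - γ - η` at
every step. Independence makes their second moments decay like `ρ ^ n` with `ρ = (1 - γ)² + ζ² < 1`.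
This yields almost sure convergence to a common limit (`IsTrajectory.exists_tendsto`,
`exists_consensus`).

The quality of the limit is controlled by the empirical average of `exp (-β L)` over the particles.
By convexity of `exp`, its loss in one step is at most `β` times the average of `exp (-β L)` times
the increment of `L`. When the derivative of `L` is frozen at the weighted mean, the linear part
disappears, because the weights are those that define the mean. The remainder is quadratic in the
deviations, hence summable in expectation (`IsTrajectory.mean_exp_sub_le`,
`integral_exp_consensus_ge`). The smallness assumption on the initial spread keeps the total loss
below `(1 - ε)` times the initial value, so `E exp (-β L(X∞)) ≥ ε E exp (-β L(Xin))`. Taking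
logarithms bounds the essential infimum.

Independently, Laplace's method at the nondegenerate minimizer shows that `E exp (-β L(Xin))` equals
`β ^ (-d/2) exp (-β L(X_*))` up to factors bounded above and below, which gives the `O(1/β)` error
(`laplace_isBigO`). -/

namespace CBO

/-! ### Second derivatives and Taylor estimates. -/

section Calculus

variable {d : ℕ} {L : Space d → ℝ}

theorem differentiable_fderiv_of_contDiff_two (hL : ContDiff ℝ 2 L) :
    Differentiable ℝ (fderiv ℝ L) :=
  (hL.fderiv_right (m := 1) (by norm_num)).differentiable (by norm_num)

theorem fderiv_fderiv_apply (hL : ContDiff ℝ 2 L) (x u v : Space d) :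
    fderiv ℝ (fderiv ℝ L) x u v =
      ∑ i, ∑ j, u i * v j * hessian L x i j := by
  have key : ∀ i j, hessian L x i j = fderiv ℝ (fderiv ℝ L) x (EuclideanSpace.single i 1)
      (EuclideanSpace.single j 1) := by
    intro i j
    have h := (differentiable_fderiv_of_contDiff_two hL x).hasFDerivAt.clm_apply
      (hasFDerivAt_const (EuclideanSpace.single j (1 : ℝ)) x)
    simp [hessian, h.fderiv]
  have hu : ∀ w : Space d, w = ∑ i, w i • (EuclideanSpace.single i (1 : ℝ) : Space d) := by
    intro w
    conv_lhs => rw [← (EuclideanSpace.basisFun (Fin d) ℝ).sum_repr w]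
    simp
  conv_lhs => rw [hu u, hu v]
  simp only [map_sum, map_smul, FunLike.coe_sum, Finset.sum_apply, smul_apply, smul_eq_mul, key,
    Finset.mul_sum]
  refine Finset.sum_comm.trans (Finset.sum_congr rfl fun i _ => Finset.sum_congr rfl fun j _ => ?_)
  ring

theorem fderiv_fderiv_apply_eq_inner (hL : ContDiff ℝ 2 L) (x u v : Space d) :
    fderiv ℝ (fderiv ℝ L) x u v =
      inner ℝ u (Matrix.toEuclideanCLM (n := Fin d) (𝕜 := ℝ) (hessian L x) v) := by
  rw [fderiv_fderiv_apply hL, EuclideanSpace.inner_eq_star_dotProduct]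
  simp only [Matrix.ofLp_toEuclideanCLM, dotProduct, Matrix.mulVec, Finset.sum_mul, star_trivial,
    Pi.star_apply]
  refine Finset.sum_congr rfl fun i _ => Finset.sum_congr rfl fun j _ => ?_
  ring

theorem fderiv_fderiv_apply_self (hL : ContDiff ℝ 2 L) (x v : Space d) :
    fderiv ℝ (fderiv ℝ L) x v v =
      star (WithLp.ofLp v) ⬝ᵥ (hessian L x).mulVec (WithLp.ofLp v) := by
  rw [fderiv_fderiv_apply hL]
  simp only [dotProduct, Matrix.mulVec, Finset.mul_sum, star_trivial]
  refine Finset.sum_congr rfl fun i _ => Finset.sum_congr rfl fun j _ => ?_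
  ring

theorem norm_fderiv_fderiv_le (hL : ContDiff ℝ 2 L)
    (hb : BddAbove (Set.range fun x => spectralNorm (hessian L x))) (x : Space d) :
    ‖fderiv ℝ (fderiv ℝ L) x‖ ≤ hessianBound L := by
  refine le_trans ?_ (le_ciSup hb x)
  refine ContinuousLinearMap.opNorm_le_bound₂ _ (norm_nonneg _) fun u v => ?_
  rw [fderiv_fderiv_apply_eq_inner hL]
  refine (norm_inner_le_norm _ _).trans ?_
  calc _ ≤ ‖u‖ * (spectralNorm (hessian L x) * ‖v‖) := by
        gcongr
        exact ContinuousLinearMap.le_opNorm _ _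
    _ = _ := by simp only [spectralNorm]; ring

theorem hessianBound_nonneg : 0 ≤ hessianBound L :=
  Real.iSup_nonneg fun _ => norm_nonneg _

theorem norm_fderiv_sub_le (hL : ContDiff ℝ 2 L)
    (hb : BddAbove (Set.range fun x => spectralNorm (hessian L x))) (x y : Space d) :
    ‖fderiv ℝ L x - fderiv ℝ L y‖ ≤ hessianBound L * ‖x - y‖ :=
  convex_univ.norm_image_sub_le_of_norm_fderiv_le
    (fun z _ => differentiable_fderiv_of_contDiff_two hL z)
    (fun z _ => norm_fderiv_fderiv_le hL hb z) (Set.mem_univ y) (Set.mem_univ x)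

/-- First-order expansion of an increment, with the derivative frozen at a nearby point `z`. -/
theorem abs_sub_sub_fderiv_le (hL : ContDiff ℝ 2 L)
    (hb : BddAbove (Set.range fun x => spectralNorm (hessian L x))) {x y z : Space d} {R : ℝ}
    (hx : ‖x - z‖ ≤ R) (hy : ‖y - z‖ ≤ R) :
    |L y - L x - fderiv ℝ L z (y - x)| ≤ hessianBound L * R * ‖y - x‖ := by
  refine (convex_closedBall z R).norm_image_sub_le_of_norm_fderiv_le' (𝕜 := ℝ)
    (fun w _ => hL.differentiable (by norm_num) w) (fun w hw => ?_)
    (mem_closedBall_iff_norm.2 hx) (mem_closedBall_iff_norm.2 hy)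
  refine (norm_fderiv_sub_le hL hb w z).trans ?_
  gcongr
  · exact hessianBound_nonneg
  · exact mem_closedBall_iff_norm.1 hw

/-- Second-order Taylor expansion with a small-o remainder at a critical point. -/
theorem exists_ball_abs_taylor_le (hL : ContDiff ℝ 2 L) {a : Space d} (ha : fderiv ℝ L a = 0)
    {δ : ℝ} (hδ : 0 < δ) :
    ∃ r > 0, ∀ v : Space d, ‖v‖ < r →
      |L (a + v) - L a - 1 / 2 * fderiv ℝ (fderiv ℝ L) a v v| ≤ δ * ‖v‖ ^ 2 := by
  set B := fderiv ℝ (fderiv ℝ L) a with hB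
  have hsymm : ∀ u v, B u v = B v u := fun u v =>
    (hL.contDiffAt.isSymmSndFDerivAt (by simp)).eq u v
  have hdiff := (differentiable_fderiv_of_contDiff_two hL a).hasFDerivAt.isLittleO
  obtain ⟨r, hr, hball⟩ := Metric.eventually_nhds_iff.1 (hdiff.def hδ)
  refine ⟨r, hr, fun v hv => ?_⟩
  -- Removing half the quadratic form leaves a function whose derivative is `o(‖w‖)`, by
  -- differentiability of `fderiv ℝ L` at `a`; symmetry of `B` enters here. The mean value
  -- inequality on the ball of radius `‖v‖` concludes.
  set q : Space d → ℝ := fun w => L (a + w) - 1 / 2 * B w w with hq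
  have hqd : ∀ w, HasFDerivAt q (fderiv ℝ L (a + w) - B w) w := by
    intro w
    have h1 : HasFDerivAt (fun w => L (a + w)) (fderiv ℝ L (a + w)) w := by
      have := (hL.differentiable (by norm_num) (a + w)).hasFDerivAt.comp w
        ((hasFDerivAt_id w).const_add a)
      simpa [Function.comp_def] using this
    have h2 : HasFDerivAt (fun w => B w w) (B w + B.flip w) w := by
      have := B.hasFDerivAt (x := w).clm_apply (hasFDerivAt_id w)
      refine this.congr_fderiv ?_
      ext u; simp
    refine (h1.sub (h2.const_mul (1 / 2))).congr_fderiv ?_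
    ext u
    simp [hsymm u w]
    ring
  have key := (convex_closedBall (0 : Space d) ‖v‖).norm_image_sub_le_of_norm_hasFDerivWithin_le
    (𝕜 := ℝ) (f := q) (C := δ * ‖v‖) (fun w _ => (hqd w).hasFDerivWithinAt) (fun w hw => ?_)
    (x := 0) (y := v) (by simp) (by simp)
  · simp only [hq, Real.norm_eq_abs, add_zero, map_zero, sub_zero, mul_zero] at key
    calc _ = |L (a + v) - 1 / 2 * B v v - L a| := by congr 1; ring
      _ ≤ _ := key
      _ = _ := by ring
  · have hw' : ‖w‖ ≤ ‖v‖ := by simpa using hw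
    have := @hball (a + w) (by simpa using hw'.trans_lt hv)
    simp only [ha, sub_zero, add_sub_cancel_left] at this
    refine this.trans ?_
    gcongr

end Calculus

/-! ### Nondegeneracy of the minimizer. -/

section Minimizer

variable {d : ℕ} {L : Space d → ℝ} {Xstar : Space d}

theorem Objective.le (hL : Objective L Xstar) (x : Space d) : L Xstar ≤ L x := by
  rcases eq_or_ne x Xstar with rfl | h
  · exact le_rfl
  · exact (hL.unique_min x h).le

theorem Objective.minValue_eq (hL : Objective L Xstar) : minValue L = L Xstar :=
  le_antisymm (ciInf_le ⟨L Xstar, by rintro _ ⟨x, rfl⟩; exact hL.le x⟩ Xstar)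
    (le_ciInf hL.le)

theorem Objective.fderiv_eq_zero (hL : Objective L Xstar) : fderiv ℝ L Xstar = 0 :=
  IsLocalMin.fderiv_eq_zero (Eventually.of_forall hL.le)

theorem Objective.fderiv_fderiv_nonneg (hL : Objective L Xstar) (v : Space d) :
    0 ≤ fderiv ℝ (fderiv ℝ L) Xstar v v := by
  refine le_of_forall_pos_le_add fun δ hδ => ?_
  -- Chosen so that the Taylor error at `t • v` is at most `δ / 2 * t ^ 2`; minimality then gives `B
  -- v v + δ ≥ 0`.
  have hδ' : 0 < δ / (2 * (‖v‖ ^ 2 + 1)) := by positivity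
  obtain ⟨r, hr, h⟩ := exists_ball_abs_taylor_le hL.contDiff hL.fderiv_eq_zero hδ'
  set t := r / (2 * (‖v‖ + 1)) with ht
  have htpos : 0 < t := by positivity
  have htv : ‖t • v‖ < r := by
    rw [norm_smul, Real.norm_of_nonneg htpos.le, ht, div_mul_eq_mul_div, div_lt_iff₀ (by positivity)]
    nlinarith [norm_nonneg v]
  have h1 := (abs_le.1 (h (t • v) htv)).2
  have h2 := hL.le (Xstar + t • v)
  simp only [map_smul, smul_apply, smul_eq_mul, norm_smul,
    Real.norm_of_nonneg htpos.le] at h1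
  have h3 : δ / (2 * (‖v‖ ^ 2 + 1)) * (t * ‖v‖) ^ 2 ≤ δ / 2 * t ^ 2 := by
    rw [div_mul_eq_mul_div, div_le_iff₀ (by positivity)]
    nlinarith [mul_pos hδ (pow_pos htpos 2)]
  have h4 : 0 ≤ t ^ 2 * (fderiv ℝ (fderiv ℝ L) Xstar v v + δ) := by nlinarith
  linarith [nonneg_of_mul_nonneg_right h4 (by positivity)]

theorem Objective.hessian_posDef (hL : Objective L Xstar) : (hessian L Xstar).PosDef := by
  have hs : (hessian L Xstar).PosSemidef := by
    refine Matrix.PosSemidef.of_dotProduct_mulVec_nonneg ?_ fun x => ?_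
    · ext i j
      have := (hL.contDiff.contDiffAt (x := Xstar)).isSymmSndFDerivAt (by simp)
      have := this.eq (EuclideanSpace.single i 1) (EuclideanSpace.single j 1)
      rw [fderiv_fderiv_apply hL.contDiff, fderiv_fderiv_apply hL.contDiff] at this
      simpa [Pi.single_apply] using this.symm
    · have := hL.fderiv_fderiv_nonneg (WithLp.toLp 2 x)
      rw [fderiv_fderiv_apply_self hL.contDiff] at this
      exact this
  exact hs.posDef_iff_det_ne_zero.2 hL.det_pos.ne'

/-- A positive definite form attains a positive minimum on the compact unit sphere, and homogeneity
does the rest. The sphere is empty when `d = 0`, where any constant works. -/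
theorem Objective.exists_coercive (hL : Objective L Xstar) :
    ∃ c > 0, ∀ v : Space d, c * ‖v‖ ^ 2 ≤ fderiv ℝ (fderiv ℝ L) Xstar v v := by
  set B := fderiv ℝ (fderiv ℝ L) Xstar with hB
  have hpos : ∀ v : Space d, v ≠ 0 → 0 < B v v := by
    intro v hv
    have := hL.hessian_posDef.dotProduct_mulVec_pos (x := WithLp.ofLp v) (by simpa using hv)
    rw [hB, fderiv_fderiv_apply_self hL.contDiff]
    exact this
  have hcont : Continuous fun v => B v v := by fun_prop
  rcases (Metric.sphere (0 : Space d) 1).eq_empty_or_nonempty with he | hne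
  · refine ⟨1, one_pos, fun v => ?_⟩
    rcases eq_or_ne v 0 with rfl | hv
    · simp
    · exfalso
      have : ‖v‖⁻¹ • v ∈ Metric.sphere (0 : Space d) 1 := by
        simp [norm_smul, inv_mul_cancel₀ (norm_ne_zero_iff.2 hv)]
      simp [he] at this
  · obtain ⟨u, hu, hmin⟩ := (isCompact_sphere (0 : Space d) 1).exists_isMinOn hne hcont.continuousOn
    refine ⟨B u u, hpos u (by rintro rfl; simp at hu), fun v => ?_⟩
    rcases eq_or_ne v 0 with rfl | hv
    · simp
    · have hv' := norm_pos_iff.2 hv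
      have : ‖v‖⁻¹ • v ∈ Metric.sphere (0 : Space d) 1 := by
        simp [norm_smul, inv_mul_cancel₀ hv'.ne']
      have h := hmin this
      simp only [Set.mem_ofPred_eq, map_smul, smul_apply, smul_eq_mul] at h
      rw [← mul_assoc, ← mul_inv, ← sq, inv_mul_eq_div, le_div_iff₀ (by positivity)] at h
      exact h

/-- Near a nondegenerate minimizer the objective is pinched between two quadratics. -/
theorem Objective.exists_quadratic_bounds (hL : Objective L Xstar) :
    ∃ r > 0, ∃ c > 0, ∃ C > 0, ∀ x : Space d, ‖x - Xstar‖ < r →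
      c * ‖x - Xstar‖ ^ 2 ≤ L x - L Xstar ∧ L x - L Xstar ≤ C * ‖x - Xstar‖ ^ 2 := by
  obtain ⟨c, hc, hcoer⟩ := hL.exists_coercive
  obtain ⟨r, hr, h⟩ := exists_ball_abs_taylor_le hL.contDiff hL.fderiv_eq_zero
    -- Half the form is at least `c / 2 * ‖v‖ ^ 2`, so an error of `c / 4` leaves `c / 4`.
    (δ := c / 4) (by positivity)
  set B := fderiv ℝ (fderiv ℝ L) Xstar with hB
  refine ⟨r, hr, c / 4, by positivity, ‖B‖ / 2 + c / 4, by positivity, fun x hx => ?_⟩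
  have h1 := abs_le.1 (h (x - Xstar) hx)
  rw [add_sub_cancel] at h1
  have h2 := hcoer (x - Xstar)
  have h3 : B (x - Xstar) (x - Xstar) ≤ ‖B‖ * ‖x - Xstar‖ * ‖x - Xstar‖ :=
    (le_abs_self _).trans (B.le_opNorm₂ _ _)
  constructor <;> nlinarith

end Minimizer

/-! ### Laplace's method for the reference law. -/

section Laplace

variable {d : ℕ} {L : Space d → ℝ} {Xstar : Space d} {Ω₀ : Type*} [MeasurableSpace Ω₀]
  {P₀ : Measure Ω₀} {Xin : Ω₀ → Space d} {f : Space d → ℝ}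

theorem ReferenceLaw.integrable_density [IsProbabilityMeasure P₀]
    (h : ReferenceLaw P₀ Xin f Xstar) : Integrable f := by
  refine ⟨h.measurable_density.aestronglyMeasurable, ?_⟩
  rw [hasFiniteIntegral_iff_ofReal (Eventually.of_forall h.density_nonneg)]
  have : IsProbabilityMeasure (P₀.map Xin) :=
    Measure.isProbabilityMeasure_map h.measurable_var.aemeasurable
  have h1 : (P₀.map Xin) Set.univ = 1 := measure_univ
  rw [h.law_eq, withDensity_apply _ MeasurableSet.univ, Measure.restrict_univ] at h1
  rw [h1]
  exact ENNReal.one_lt_top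

theorem ReferenceLaw.integral_comp [IsProbabilityMeasure P₀] (h : ReferenceLaw P₀ Xin f Xstar)
    {g : Space d → ℝ} (hg : Measurable g) :
    ∫ ω, g (Xin ω) ∂P₀ = ∫ x, f x * g x := by
  rw [← integral_map (f := g) h.measurable_var.aemeasurable hg.aestronglyMeasurable, h.law_eq,
    integral_withDensity_eq_integral_toReal_smul (by have := h.measurable_density; fun_prop)
      (Eventually.of_forall fun _ => ENNReal.ofReal_lt_top)]
  simp [ENNReal.toReal_ofReal (h.density_nonneg _)]

theorem ReferenceLaw.integral_density [IsProbabilityMeasure P₀]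
    (h : ReferenceLaw P₀ Xin f Xstar) : ∫ x, f x = 1 := by
  have := h.integral_comp (g := fun _ => 1) measurable_const
  simpa using this.symm

theorem ReferenceLaw.exists_ae_norm_le (h : ReferenceLaw P₀ Xin f Xstar) :
    ∃ R, ∀ᵐ ω ∂P₀, ‖Xin ω‖ ≤ R := by
  obtain ⟨R, hR⟩ := h.compactSupport.isCompact.isBounded.exists_norm_le
  refine ⟨R, ?_⟩
  have hmeas : MeasurableSet {x : Space d | ‖x‖ ≤ R} :=
    measurableSet_le measurable_norm measurable_const
  rw [← ae_map_iff (p := fun x => ‖x‖ ≤ R) h.measurable_var.aemeasurable hmeas, h.law_eq,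
    ae_withDensity_iff (by have := h.measurable_density; fun_prop)]
  refine Eventually.of_forall fun x hx => hR x (subset_tsupport f ?_)
  intro h0
  simp [h0] at hx

/-- Outside a neighbourhood of the minimizer and on the support of the density, the objective
stays bounded away from its minimal value. -/
theorem exists_gap (hL : Objective L Xstar) (h : ReferenceLaw P₀ Xin f Xstar) {r : ℝ} (hr : 0 < r) :
    ∃ δ > 0, ∀ x, r ≤ ‖x - Xstar‖ → f x ≠ 0 → δ ≤ L x - L Xstar := by
  have hK : IsCompact (tsupport f ∩ (Metric.ball Xstar r)ᶜ) :=
    h.compactSupport.isCompact.inter_right Metric.isOpen_ball.isClosed_compl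
  rcases (tsupport f ∩ (Metric.ball Xstar r)ᶜ).eq_empty_or_nonempty with he | hne
  · refine ⟨1, one_pos, fun x hx hfx => ?_⟩
    have : x ∈ tsupport f ∩ (Metric.ball Xstar r)ᶜ :=
      ⟨subset_tsupport f hfx, by simpa [dist_eq_norm] using hx⟩
    simp [he] at this
  · obtain ⟨y, hy, hmin⟩ := hK.exists_isMinOn hne hL.contDiff.continuous.continuousOn
    have hyne : y ≠ Xstar := by
      rintro rfl
      exact hy.2 (by simpa using hr)
    refine ⟨L y - L Xstar, sub_pos.2 (hL.unique_min y hyne), fun x hx hfx => ?_⟩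
    exact sub_le_sub_right
      (hmin ⟨subset_tsupport f hfx, by simpa [dist_eq_norm] using hx⟩) _

theorem Objective.exp_le_one (hL : Objective L Xstar) {β : ℝ} (hβ : 0 ≤ β) (x : Space d) :
    Real.exp (-β * (L x - L Xstar)) ≤ 1 := by
  rw [Real.exp_le_one_iff]
  nlinarith [hL.le x]

theorem integrable_density_mul_exp [IsProbabilityMeasure P₀] (hL : Objective L Xstar)
    (h : ReferenceLaw P₀ Xin f Xstar) {β : ℝ} (hβ : 0 ≤ β) :
    Integrable fun x => f x * Real.exp (-β * (L x - L Xstar)) := by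
  refine h.integrable_density.mul_bdd (c := 1) ?_ (Eventually.of_forall fun x => ?_)
  · have := hL.contDiff.continuous
    exact Continuous.aestronglyMeasurable (by fun_prop)
  · rw [Real.norm_of_nonneg (Real.exp_pos _).le]
    exact hL.exp_le_one hβ x

/-- Near the minimizer the integrand is below a Gaussian, whose integral scales exactly like `β ^
(-d/2)`; elsewhere the gap `δ` gives at most `exp (-δ β)`, which beats any power of `β`. -/
theorem laplace_upper [IsProbabilityMeasure P₀] (hL : Objective L Xstar)
    (h : ReferenceLaw P₀ Xin f Xstar) :
    ∃ b, ∀ᶠ β : ℝ in atTop,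
      β ^ ((d : ℝ) / 2) * ∫ x, f x * Real.exp (-β * (L x - L Xstar)) ≤ b := by
  obtain ⟨r₁, hr₁, c, hc, C, hC, hquad⟩ := hL.exists_quadratic_bounds
  obtain ⟨r₂, hr₂, hf⟩ := Metric.eventually_nhds_iff.1
    (h.continuousAt.eventually (gt_mem_nhds (lt_add_one (f Xstar))))
  obtain ⟨δ, hδ, hgap⟩ := exists_gap hL h (lt_min hr₁ hr₂)
  have hM : 0 < f Xstar + 1 := by linarith [h.pos]
  refine ⟨(f Xstar + 1) * (Real.pi / c) ^ ((d : ℝ) / 2) + 1, ?_⟩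
  have hdecay := (tendsto_rpow_mul_exp_neg_mul_atTop_nhds_zero ((d : ℝ) / 2) δ hδ).eventually
    (gt_mem_nhds one_pos)
  filter_upwards [hdecay, eventually_gt_atTop 0] with β hβ1 hβ
  have hgauss : Integrable fun x : Space d => Real.exp (-(β * c) * ‖x - Xstar‖ ^ 2) := by
    have := (GaussianFourier.integrable_cexp_neg_mul_sq_norm_add (V := Space d)
      (b := ((β * c : ℝ) : ℂ)) (by simpa using mul_pos hβ hc) 0 0).norm
    refine (this.comp_sub_right Xstar).congr (Eventually.of_forall fun x => ?_)
    simp only [Complex.norm_exp, zero_mul, add_zero]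
    norm_cast
  have hgi : ∫ x : Space d, Real.exp (-(β * c) * ‖x - Xstar‖ ^ 2) =
      (Real.pi / (β * c)) ^ ((d : ℝ) / 2) := by
    rw [integral_sub_right_eq_self (fun x : Space d => Real.exp (-(β * c) * ‖x‖ ^ 2)) Xstar]
    have := GaussianFourier.integral_rexp_neg_mul_sq_norm (V := Space d) (mul_pos hβ hc)
    simpa using this
  have hle : ∫ x, f x * Real.exp (-β * (L x - L Xstar)) ≤
      (f Xstar + 1) * (Real.pi / (β * c)) ^ ((d : ℝ) / 2) + Real.exp (-δ * β) := by
    calc _ ≤ ∫ x, ((f Xstar + 1) * Real.exp (-(β * c) * ‖x - Xstar‖ ^ 2)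
            + f x * Real.exp (-δ * β)) := by
          refine integral_mono (integrable_density_mul_exp hL h hβ.le)
            ((hgauss.const_mul _).add (h.integrable_density.mul_const _)) fun x => ?_
          have hfx := h.density_nonneg x
          dsimp only
          rcases lt_or_ge ‖x - Xstar‖ (min r₁ r₂) with hx | hx
          · have h1 := (hquad x (hx.trans_le (min_le_left _ _))).1
            have h2 : f x < f Xstar + 1 :=
              hf (by rw [dist_eq_norm]; exact hx.trans_le (min_le_right _ _))
            have h3 : Real.exp (-β * (L x - L Xstar)) ≤
                Real.exp (-(β * c) * ‖x - Xstar‖ ^ 2) := by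
              rw [Real.exp_le_exp]
              nlinarith
            have h4 : 0 ≤ f x * Real.exp (-δ * β) := by positivity
            have h5 := mul_le_mul h2.le h3 (Real.exp_pos _).le hM.le
            linarith
          · have h4 : 0 ≤ (f Xstar + 1) * Real.exp (-(β * c) * ‖x - Xstar‖ ^ 2) := by positivity
            refine le_add_of_nonneg_of_le h4 ?_
            rcases eq_or_ne (f x) 0 with h0 | h0
            · simp [h0]
            · refine mul_le_mul_of_nonneg_left ?_ hfx
              rw [Real.exp_le_exp]
              nlinarith [hgap x hx h0]
      _ = _ := by
          rw [integral_add (hgauss.const_mul _) (h.integrable_density.mul_const _),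
            integral_const_mul, integral_mul_const, h.integral_density, hgi, one_mul]
  have hpow : 0 < β ^ ((d : ℝ) / 2) := Real.rpow_pos_of_pos hβ _
  have hsplit : β ^ ((d : ℝ) / 2) * (Real.pi / (β * c)) ^ ((d : ℝ) / 2) =
      (Real.pi / c) ^ ((d : ℝ) / 2) := by
    rw [← Real.mul_rpow hβ.le (by positivity)]
    congr 1
    field_simp
  calc _ ≤ β ^ ((d : ℝ) / 2) *
        ((f Xstar + 1) * (Real.pi / (β * c)) ^ ((d : ℝ) / 2) + Real.exp (-δ * β)) := by gcongr
    _ = (f Xstar + 1) * (β ^ ((d : ℝ) / 2) * (Real.pi / (β * c)) ^ ((d : ℝ) / 2))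
        + β ^ ((d : ℝ) / 2) * Real.exp (-δ * β) := by ring
    _ ≤ _ := by rw [hsplit]; gcongr

/-- It suffices to integrate over the ball of radius `β ^ (-1/2)`: there the exponent is at least
`-C`, and the volume is a multiple of `β ^ (-d/2)`. -/
theorem laplace_lower [IsProbabilityMeasure P₀] (hL : Objective L Xstar)
    (h : ReferenceLaw P₀ Xin f Xstar) :
    ∃ a > 0, ∀ᶠ β : ℝ in atTop,
      a ≤ β ^ ((d : ℝ) / 2) * ∫ x, f x * Real.exp (-β * (L x - L Xstar)) := by
  obtain ⟨r₁, hr₁, c, hc, C, hC, hquad⟩ := hL.exists_quadratic_bounds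
  obtain ⟨r₂, hr₂, hf⟩ := Metric.eventually_nhds_iff.1
    (h.continuousAt.eventually (lt_mem_nhds (half_lt_self h.pos)))
  have hf0 := h.pos
  have hV : 0 < volume.real (Metric.ball (0 : Space d) 1) :=
    ENNReal.toReal_pos (Metric.measure_ball_pos _ _ one_pos).ne' measure_ball_lt_top.ne
  refine ⟨f Xstar / 2 * Real.exp (-C) * volume.real (Metric.ball (0 : Space d) 1), by positivity, ?_⟩
  have hsmall : ∀ᶠ β : ℝ in atTop, β ^ (-(1 / 2) : ℝ) < min r₁ r₂ :=
    (tendsto_rpow_neg_atTop (by norm_num)).eventually (gt_mem_nhds (lt_min hr₁ hr₂))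
  filter_upwards [hsmall, eventually_gt_atTop 0] with β hβ1 hβ
  set ρ := β ^ (-(1 / 2) : ℝ) with hρ
  have hρpos : 0 < ρ := Real.rpow_pos_of_pos hβ _
  have hρ2 : β * ρ ^ 2 = 1 := by
    rw [hρ, ← Real.rpow_natCast, ← Real.rpow_mul hβ.le]
    norm_num
    rw [Real.rpow_neg_one, mul_inv_cancel₀ hβ.ne']
  have hρd : β ^ ((d : ℝ) / 2) * ρ ^ d = 1 := by
    rw [hρ, ← Real.rpow_natCast, ← Real.rpow_mul hβ.le, ← Real.rpow_add hβ]
    ring_nf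
    simp
  have hle : f Xstar / 2 * Real.exp (-C) * volume.real (Metric.ball Xstar ρ) ≤
      ∫ x, f x * Real.exp (-β * (L x - L Xstar)) := by
    calc _ = ∫ x in Metric.ball Xstar ρ, f Xstar / 2 * Real.exp (-C) := by
          rw [setIntegral_const, smul_eq_mul, mul_comm]
      _ ≤ ∫ x in Metric.ball Xstar ρ, f x * Real.exp (-β * (L x - L Xstar)) := by
          refine setIntegral_mono_on (integrableOn_const measure_ball_lt_top.ne)
            (integrable_density_mul_exp hL h hβ.le).integrableOn measurableSet_ball fun x hx => ?_
          rw [mem_ball_iff_norm] at hx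
          have h1 := (hquad x (hx.trans (hβ1.trans_le (min_le_left _ _)))).2
          have h2 : f Xstar / 2 < f x :=
            hf (by rw [dist_eq_norm]; exact hx.trans (hβ1.trans_le (min_le_right _ _)))
          have h3 : ‖x - Xstar‖ ^ 2 ≤ ρ ^ 2 := by gcongr
          have h4 : Real.exp (-C) ≤ Real.exp (-β * (L x - L Xstar)) := by
            rw [Real.exp_le_exp]
            have : β * (L x - L Xstar) ≤ β * (C * ρ ^ 2) := by
              gcongr
              exact h1.trans (by gcongr)
            nlinarith
          exact mul_le_mul h2.le h4 (Real.exp_pos _).le (h.density_nonneg x)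
      _ ≤ _ := setIntegral_le_integral (integrable_density_mul_exp hL h hβ.le)
          (Eventually.of_forall fun x => mul_nonneg (h.density_nonneg x) (Real.exp_pos _).le)
  have hvol : volume.real (Metric.ball Xstar ρ) =
      ρ ^ d * volume.real (Metric.ball (0 : Space d) 1) := by
    rw [Measure.real, Measure.addHaar_ball_of_pos _ _ hρpos, ENNReal.toReal_mul,
      ENNReal.toReal_ofReal (by positivity)]
    simp [Measure.real]
  rw [hvol] at hle
  calc _ = β ^ ((d : ℝ) / 2) * ρ ^ d *
        (f Xstar / 2 * Real.exp (-C) * volume.real (Metric.ball (0 : Space d) 1)) := by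
        rw [hρd, one_mul]
    _ = β ^ ((d : ℝ) / 2) * (f Xstar / 2 * Real.exp (-C) *
        (ρ ^ d * volume.real (Metric.ball (0 : Space d) 1))) := by ring
    _ ≤ _ := by gcongr

/-- Laplace's principle: the defect in the expansion of the free energy is `O(1/β)`. -/
theorem laplace_isBigO [IsProbabilityMeasure P₀] (hL : Objective L Xstar)
    (h : ReferenceLaw P₀ Xin f Xstar) (ε : ℝ) :
    (fun β : ℝ => -(1 / β) * Real.log (∫ ω, Real.exp (-β * L (Xin ω)) ∂P₀)
      - (1 / β) * Real.log ε - L Xstar - (d : ℝ) / 2 * (Real.log β / β))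
      =O[atTop] (fun β : ℝ => 1 / β) := by
  obtain ⟨a, ha, hlow⟩ := laplace_lower hL h
  obtain ⟨b, hup⟩ := laplace_upper hL h
  refine IsBigO.of_bound (|Real.log a| + |Real.log b| + |Real.log ε|) ?_
  filter_upwards [hlow, hup, eventually_gt_atTop 0] with β h1 h2 hβ
  set J := ∫ x, f x * Real.exp (-β * (L x - L Xstar)) with hJ
  have hpow : 0 < β ^ ((d : ℝ) / 2) := Real.rpow_pos_of_pos hβ _
  have hJpos : 0 < J := by
    have := ha.trans_le h1
    exact pos_of_mul_pos_right this hpow.le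
  have hI : ∫ ω, Real.exp (-β * L (Xin ω)) ∂P₀ = Real.exp (-β * L Xstar) * J := by
    have hc := hL.contDiff.continuous
    rw [h.integral_comp (g := fun x => Real.exp (-β * L x))
      (Continuous.measurable (by fun_prop)), hJ, ← integral_const_mul]
    congr 1
    ext x
    rw [mul_left_comm, ← Real.exp_add]
    ring_nf
  have hlogI : Real.log (∫ ω, Real.exp (-β * L (Xin ω)) ∂P₀) = -β * L Xstar + Real.log J := by
    rw [hI, Real.log_mul (Real.exp_pos _).ne' hJpos.ne', Real.log_exp]
  have hlog : Real.log (β ^ ((d : ℝ) / 2) * J) = (d : ℝ) / 2 * Real.log β + Real.log J := by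
    rw [Real.log_mul hpow.ne' hJpos.ne', Real.log_rpow hβ]
  have hbd : |Real.log (β ^ ((d : ℝ) / 2) * J)| ≤ |Real.log a| + |Real.log b| := by
    have e1 := Real.log_le_log ha h1
    have e2 := Real.log_le_log (ha.trans_le h1) h2
    rw [abs_le]
    constructor
    · linarith [neg_abs_le (Real.log a), abs_nonneg (Real.log b)]
    · linarith [le_abs_self (Real.log b), abs_nonneg (Real.log a)]
  have hE : -(1 / β) * Real.log (∫ ω, Real.exp (-β * L (Xin ω)) ∂P₀)
      - (1 / β) * Real.log ε - L Xstar - (d : ℝ) / 2 * (Real.log β / β) =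
      -(Real.log (β ^ ((d : ℝ) / 2) * J) + Real.log ε) * (1 / β) := by
    rw [hlogI, hlog]
    field_simp
    ring
  rw [hE, norm_mul, norm_neg]
  gcongr
  exact (norm_add_le _ _).trans (add_le_add_left hbd _)

end Laplace

end CBO

/-! ### Pathwise estimates along a deterministic trajectory. -/

noncomputable section

namespace CBO

/-- The per-coordinate spread `maxᵢ (yᵢ - ȳ)²` of a configuration around its ensemble mean. -/
def spread {d N : ℕ} (y : Fin N → Space d) (l : Fin d) : ℝ :=
  ⨆ i, (y i l - ensembleMean y l) ^ 2

/-- The factor by which coordinate `l` of particle differences is scaled after `n` steps. -/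
def contraction {d : ℕ} (γ : ℝ) (η : ℕ → Fin d → ℝ) (n : ℕ) (l : Fin d) : ℝ :=
  ∏ k ∈ Finset.range n, (1 - γ - η k l)

/-- The quadratic function of the noise that controls the one-step variation, with weight `s`. -/
def stepCost (γ s y : ℝ) : ℝ := s / 2 * (1 + (1 - γ - y) ^ 2) + (γ + y) ^ 2 / (2 * s)

/-- The bound for the one-step variation in coordinate `l` at time `n`. -/
def stepBound {d N : ℕ} (γ s : ℝ) (η : ℕ → Fin d → ℝ) (y : Fin N → Space d) (n : ℕ)
    (l : Fin d) : ℝ :=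
  contraction γ η n l ^ 2 * stepCost γ s (η n l) * spread y l

/-- A deterministic trajectory of the scheme driven by the noise sequence `η`. -/
def IsTrajectory {d N : ℕ} (L : Space d → ℝ) (β γ : ℝ) (η : ℕ → Fin d → ℝ)
    (x : ℕ → Fin N → Space d) : Prop :=
  ∀ n i, x (n + 1) i = x n i - γ • (x n i - weightedMean β L (x n))
    - ∑ l, ((x n i l - weightedMean β L (x n) l) * η n l) • (EuclideanSpace.single l 1 : Space d)

section Pathwise

variable {d N : ℕ} {L : Space d → ℝ} {β γ s : ℝ} {η : ℕ → Fin d → ℝ} {x : ℕ → Fin N → Space d}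

theorem le_spread (y : Fin N → Space d) (l : Fin d) (i : Fin N) :
    (y i l - ensembleMean y l) ^ 2 ≤ spread y l :=
  le_ciSup (f := fun i => (y i l - ensembleMean y l) ^ 2) (Set.finite_range _).bddAbove i

theorem spread_nonneg (y : Fin N → Space d) (l : Fin d) : 0 ≤ spread y l :=
  Real.iSup_nonneg fun _ => sq_nonneg _

theorem stepCost_nonneg (hs : 0 < s) (y : ℝ) : 0 ≤ stepCost γ s y := by
  unfold stepCost; positivity

theorem stepBound_nonneg (hs : 0 < s) (y : Fin N → Space d) (n : ℕ) (l : Fin d) :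
    0 ≤ stepBound γ s η y n l :=
  mul_nonneg (mul_nonneg (sq_nonneg _) (stepCost_nonneg hs _)) (spread_nonneg _ _)

theorem IsTrajectory.step (h : IsTrajectory L β γ η x) (n : ℕ) (i : Fin N) (l : Fin d) :
    x (n + 1) i l = x n i l - (γ + η n l) * (x n i l - weightedMean β L (x n) l) := by
  have h1 : (∑ k, ((x n i k - weightedMean β L (x n) k) * η n k) •
      (EuclideanSpace.single k 1 : Space d)) l = (x n i l - weightedMean β L (x n) l) * η n l := by
    simp [WithLp.ofLp_sum, Finset.sum_apply, Pi.single_apply]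
  rw [h n i, PiLp.sub_apply, h1]
  simp
  ring

/-- The weighted mean and the noise are the same for all particles, so the mean drops out of
differences. -/
theorem IsTrajectory.sub_eq (h : IsTrajectory L β γ η x) (n : ℕ) (i j : Fin N) (l : Fin d) :
    x n i l - x n j l = contraction γ η n l * (x 0 i l - x 0 j l) := by
  induction n with
  | zero => simp [contraction]
  | succ n ih =>
    rw [h.step, h.step, contraction, Finset.prod_range_succ, ← contraction, mul_right_comm, ← ih]
    ring

theorem weight_sum_pos (hN : 0 < N) (y : Fin N → Space d) :
    0 < ∑ j, Real.exp (-β * L (y j)) := by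
  have : Nonempty (Fin N) := ⟨⟨0, hN⟩⟩
  exact Finset.sum_pos (fun _ _ => Real.exp_pos _) Finset.univ_nonempty

theorem weightedMean_apply (y : Fin N → Space d) (l : Fin d) :
    weightedMean β L y l =
      (∑ j, Real.exp (-β * L (y j)))⁻¹ * ∑ j, Real.exp (-β * L (y j)) * y j l := by
  simp [weightedMean, WithLp.ofLp_sum, Finset.sum_apply]

theorem sum_weight_mul_sub_eq_zero (hN : 0 < N) (y : Fin N → Space d) (l : Fin d) :
    ∑ i, Real.exp (-β * L (y i)) * (y i l - weightedMean β L y l) = 0 := by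
  have hW := (weight_sum_pos (L := L) (β := β) hN y).ne'
  simp only [mul_sub, Finset.sum_sub_distrib, ← Finset.sum_mul]
  rw [weightedMean_apply, mul_inv_cancel_left₀ hW, sub_self]

/-- The mean squared deviation of a centred family from a weighted average of itself. -/
theorem sum_sq_sub_average_le {ι : Type*} [Fintype ι] {y p : ι → ℝ} {M : ℝ}
    (hy : ∑ i, y i = 0) (hp : ∀ i, 0 ≤ p i) (hp1 : ∑ i, p i = 1) (hM : ∀ i, y i ^ 2 ≤ M) :
    ∑ i, (y i - ∑ j, p j * y j) ^ 2 ≤ 2 * Fintype.card ι * M := by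
  set w := ∑ j, p j * y j with hw
  -- Jensen's inequality, in the form that the weighted variance is nonnegative.
  have h1 : w ^ 2 ≤ M := by
    have h0 : 0 ≤ ∑ j, p j * (y j - w) ^ 2 :=
      Finset.sum_nonneg fun j _ => mul_nonneg (hp j) (sq_nonneg _)
    have h2 : ∑ j, p j * (y j - w) ^ 2 = ∑ j, p j * y j ^ 2 - w ^ 2 := by
      calc _ = ∑ j, (p j * y j ^ 2 - 2 * w * (p j * y j) + p j * w ^ 2) :=
            Finset.sum_congr rfl fun j _ => by ring
        _ = ∑ j, p j * y j ^ 2 - 2 * w * w + 1 * w ^ 2 := by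
            rw [Finset.sum_add_distrib, Finset.sum_sub_distrib, ← Finset.mul_sum,
              ← Finset.sum_mul, hp1]
        _ = _ := by ring
    have h3 : ∑ j, p j * y j ^ 2 ≤ ∑ j, p j * M :=
      Finset.sum_le_sum fun j _ => mul_le_mul_of_nonneg_left (hM j) (hp j)
    rw [← Finset.sum_mul, hp1, one_mul] at h3
    linarith
  calc _ = ∑ i, (y i ^ 2 - 2 * w * y i + w ^ 2) := Finset.sum_congr rfl fun i _ => by ring
    _ = ∑ i, y i ^ 2 + Fintype.card ι * w ^ 2 := by
        rw [Finset.sum_add_distrib, Finset.sum_sub_distrib, ← Finset.mul_sum, hy]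
        simp
    _ ≤ ∑ _i : ι, M + Fintype.card ι * M := by
        gcongr with i
        exact hM i
    _ = _ := by simp; ring

/-- Deviations from a weighted mean depend only on particle differences, so the configuration may be
replaced by the contracted, centred initial one. Centring removes the cross term and yields the
factor `2 * N`. -/
theorem IsTrajectory.sum_sq_sub_weightedMean_le (h : IsTrajectory L β γ η x) (hN : 0 < N) (n : ℕ)
    (l : Fin d) :
    ∑ i, (x n i l - weightedMean β L (x n) l) ^ 2 ≤
      2 * N * (contraction γ η n l ^ 2 * spread (x 0) l) := by
  set q := contraction γ η n l
  set y : Fin N → ℝ := fun i => q * (x 0 i l - ensembleMean (x 0) l) with hy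
  set W := ∑ j, Real.exp (-β * L (x n j)) with hW
  have hWpos : 0 < W := weight_sum_pos hN _
  set p : Fin N → ℝ := fun j => W⁻¹ * Real.exp (-β * L (x n j)) with hp
  have hp1 : ∑ j, p j = 1 := by
    rw [hp, ← Finset.mul_sum, inv_mul_cancel₀ hWpos.ne']
  have hmean : ensembleMean (x 0) l = (N : ℝ)⁻¹ * ∑ j, x 0 j l := by
    simp [ensembleMean, WithLp.ofLp_sum, Finset.sum_apply]
  have hN' : (N : ℝ) ≠ 0 := by positivity
  have hy0 : ∑ i, y i = 0 := by
    rw [hy, ← Finset.mul_sum, Finset.sum_sub_distrib, hmean]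
    simp [hN']
  have key := sum_sq_sub_average_le (M := q ^ 2 * spread (x 0) l) hy0
    (fun j => by positivity) hp1 (fun i => by
      rw [hy, mul_pow]
      exact mul_le_mul_of_nonneg_left (le_spread _ _ _) (sq_nonneg _))
  rw [Fintype.card_fin] at key
  refine le_trans (le_of_eq ?_) key
  refine Finset.sum_congr rfl fun i _ => ?_
  congr 1
  have h1 : x n i l - weightedMean β L (x n) l = ∑ j, p j * (x n i l - x n j l) := by
    simp only [mul_sub, Finset.sum_sub_distrib, ← Finset.sum_mul, hp1, one_mul]
    rw [weightedMean_apply, Finset.mul_sum, ← hW]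
    simp only [hp, mul_assoc]
  have h2 : y i - ∑ j, p j * y j = ∑ j, p j * (y i - y j) := by
    simp only [mul_sub, Finset.sum_sub_distrib, ← Finset.sum_mul, hp1, one_mul]
  rw [h1, h2]
  refine Finset.sum_congr rfl fun j _ => ?_
  rw [h.sub_eq, hy]
  ring

theorem exp_sub_exp_le (a b : ℝ) :
    Real.exp (-β * a) - Real.exp (-β * b) ≤ β * (Real.exp (-β * a) * (b - a)) := by
  have h1 := Real.add_one_le_exp (-β * (b - a))
  have h2 : Real.exp (-β * b) = Real.exp (-β * a) * Real.exp (-β * (b - a)) := by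
    rw [← Real.exp_add]; ring_nf
  rw [h2]
  nlinarith [Real.exp_pos (-β * a)]

/-- Each step is one diagonal map, common to all particles, applied to the deviation from the
weighted mean; the weighted deviations sum to zero. -/
theorem IsTrajectory.sum_weight_mul_fderiv_eq_zero (h : IsTrajectory L β γ η x) (hN : 0 < N)
    (n : ℕ) (φ : Space d →L[ℝ] ℝ) :
    ∑ i, Real.exp (-β * L (x n i)) * φ (x (n + 1) i - x n i) = 0 := by
  have h0 : ∑ i, Real.exp (-β * L (x n i)) • (x (n + 1) i - x n i) = 0 := by
    ext l
    have := sum_weight_mul_sub_eq_zero (L := L) (β := β) hN (x n) l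
    simp only [WithLp.ofLp_sum, Finset.sum_apply, PiLp.smul_apply, PiLp.sub_apply, smul_eq_mul,
      PiLp.zero_apply, h.step]
    calc _ = -(γ + η n l) * ∑ i, Real.exp (-β * L (x n i)) *
          (x n i l - weightedMean β L (x n) l) := by
          rw [Finset.mul_sum]
          exact Finset.sum_congr rfl fun i _ => by ring
      _ = _ := by rw [this, mul_zero]
  have := congrArg φ h0
  simpa [map_sum] using this

/-- The left side is what Young's inequality with weight `s` produces from deviation times step
length. In each coordinate the new deviation and the step are multiples `1 - γ - η` and `-(γ + η)`
of the old deviation. -/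
theorem IsTrajectory.sum_stepCost_eq (h : IsTrajectory L β γ η x) (n : ℕ) (i : Fin N) :
    s / 2 * (‖x n i - weightedMean β L (x n)‖ ^ 2 + ‖x (n + 1) i - weightedMean β L (x n)‖ ^ 2)
        + ‖x (n + 1) i - x n i‖ ^ 2 / (2 * s) =
      ∑ l, stepCost γ s (η n l) * (x n i l - weightedMean β L (x n) l) ^ 2 := by
  simp only [EuclideanSpace.real_norm_sq_eq, PiLp.sub_apply, h.step]
  rw [← Finset.sum_add_distrib, Finset.mul_sum, Finset.sum_div, ← Finset.sum_add_distrib]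
  refine Finset.sum_congr rfl fun l _ => ?_
  unfold stepCost
  ring

/-- Convexity of `exp`, then expansion of `L` around the weighted mean: the linear terms cancel in
the sum over particles, and the remainders are bounded by Young's inequality and the contraction of
the spread. -/
theorem IsTrajectory.mean_exp_sub_le (h : IsTrajectory L β γ η x) (hL : ContDiff ℝ 2 L)
    (hb : BddAbove (Set.range fun x => spectralNorm (hessian L x))) {m : ℝ} (hm : ∀ x, m ≤ L x)
    (hβ : 0 < β) (hs : 0 < s) (hN : 0 < N) (n : ℕ) :
    (N : ℝ)⁻¹ * ∑ i, Real.exp (-β * L (x n i)) - (N : ℝ)⁻¹ * ∑ i, Real.exp (-β * L (x (n + 1) i)) ≤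
      2 * β * hessianBound L * Real.exp (-β * m) * ∑ l, stepBound γ s η (x 0) n l := by
  set z := weightedMean β L (x n) with hz
  have hC : 0 ≤ hessianBound L := hessianBound_nonneg
  have hterm : ∀ i, Real.exp (-β * L (x n i)) - Real.exp (-β * L (x (n + 1) i)) ≤
      β * (hessianBound L * Real.exp (-β * m) *
        ∑ l, stepCost γ s (η n l) * (x n i l - z l) ^ 2) +
      β * (Real.exp (-β * L (x n i)) * fderiv ℝ L z (x (n + 1) i - x n i)) := by
    intro i
    refine (exp_sub_exp_le _ _).trans ?_
    rw [← mul_add]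
    refine mul_le_mul_of_nonneg_left ?_ hβ.le
    -- `R` is the radius of a ball around `z` that contains both ends of the step.
    set R := max ‖x n i - z‖ ‖x (n + 1) i - z‖ with hR
    have h1 := (abs_le.1 (abs_sub_sub_fderiv_le hL hb (x := x n i) (y := x (n + 1) i) (z := z)
      (le_max_left _ _) (le_max_right _ _))).2
    have hR2 : R ^ 2 ≤ ‖x n i - z‖ ^ 2 + ‖x (n + 1) i - z‖ ^ 2 := by
      rcases max_cases ‖x n i - z‖ ‖x (n + 1) i - z‖ with ⟨e, _⟩ | ⟨e, _⟩ <;>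
        · rw [hR, e]; nlinarith [sq_nonneg ‖x n i - z‖, sq_nonneg ‖x (n + 1) i - z‖]
    have hamgm : R * ‖x (n + 1) i - x n i‖ ≤
        ∑ l, stepCost γ s (η n l) * (x n i l - z l) ^ 2 := by
      rw [hz, ← h.sum_stepCost_eq n i, ← hz]
      have e : R * ‖x (n + 1) i - x n i‖ ≤ s / 2 * R ^ 2 + ‖x (n + 1) i - x n i‖ ^ 2 / (2 * s) := by
        have : s / 2 * R ^ 2 + ‖x (n + 1) i - x n i‖ ^ 2 / (2 * s) - R * ‖x (n + 1) i - x n i‖ =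
            (s * R - ‖x (n + 1) i - x n i‖) ^ 2 / (2 * s) := by
          field_simp
          ring
        have : 0 ≤ (s * R - ‖x (n + 1) i - x n i‖) ^ 2 / (2 * s) := by positivity
        linarith
      refine e.trans ?_
      gcongr
    have hw : Real.exp (-β * L (x n i)) ≤ Real.exp (-β * m) := by
      rw [Real.exp_le_exp]
      nlinarith [hm (x n i)]
    have hR0 : 0 ≤ R * ‖x (n + 1) i - x n i‖ :=
      mul_nonneg ((norm_nonneg _).trans (le_max_left _ _)) (norm_nonneg _)
    calc Real.exp (-β * L (x n i)) * (L (x (n + 1) i) - L (x n i))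
        ≤ Real.exp (-β * L (x n i)) * (hessianBound L * (R * ‖x (n + 1) i - x n i‖) +
          fderiv ℝ L z (x (n + 1) i - x n i)) := by
          gcongr
          linarith
      _ = Real.exp (-β * L (x n i)) * (hessianBound L * (R * ‖x (n + 1) i - x n i‖)) +
          Real.exp (-β * L (x n i)) * fderiv ℝ L z (x (n + 1) i - x n i) := by ring
      _ ≤ Real.exp (-β * m) * (hessianBound L *
          ∑ l, stepCost γ s (η n l) * (x n i l - z l) ^ 2) +
          Real.exp (-β * L (x n i)) * fderiv ℝ L z (x (n + 1) i - x n i) := by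
          gcongr
      _ = _ := by ring
  have hsum := Finset.sum_le_sum fun i (_ : i ∈ Finset.univ) => hterm i
  rw [Finset.sum_sub_distrib, Finset.sum_add_distrib, ← Finset.mul_sum, ← Finset.mul_sum,
    ← Finset.mul_sum, h.sum_weight_mul_fderiv_eq_zero hN n, mul_zero, add_zero,
    Finset.sum_comm] at hsum
  simp only [← Finset.mul_sum] at hsum
  have hN' : (0 : ℝ) < N := by exact_mod_cast hN
  have hspread : ∑ l, stepCost γ s (η n l) * ∑ i, (x n i l - z l) ^ 2 ≤
      2 * N * ∑ l, stepBound γ s η (x 0) n l := by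
    rw [Finset.mul_sum]
    refine Finset.sum_le_sum fun l _ => ?_
    refine (mul_le_mul_of_nonneg_left (h.sum_sq_sub_weightedMean_le hN n l)
      (stepCost_nonneg hs _)).trans (le_of_eq ?_)
    unfold stepBound
    ring
  rw [← mul_sub, inv_mul_le_iff₀ hN']
  refine hsum.trans ?_
  calc _ ≤ β * (hessianBound L * Real.exp (-β * m) *
        (2 * N * ∑ l, stepBound γ s η (x 0) n l)) := by gcongr
    _ = _ := by ring

theorem IsTrajectory.norm_sq_step_le (h : IsTrajectory L β γ η x) (hs : 0 < s) (hN : 0 < N)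
    (n : ℕ) (i : Fin N) :
    ‖x (n + 1) i - x n i‖ ^ 2 ≤ 2 * s * (2 * N * ∑ l, stepBound γ s η (x 0) n l) := by
  have h1 := h.sum_stepCost_eq (s := s) n i
  have h2 : ∑ l, stepCost γ s (η n l) * (x n i l - weightedMean β L (x n) l) ^ 2 ≤
      2 * N * ∑ l, stepBound γ s η (x 0) n l := by
    rw [Finset.mul_sum]
    refine Finset.sum_le_sum fun l _ => ?_
    have h3 : (x n i l - weightedMean β L (x n) l) ^ 2 ≤
        2 * N * (contraction γ η n l ^ 2 * spread (x 0) l) :=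
      (Finset.single_le_sum (f := fun i => (x n i l - weightedMean β L (x n) l) ^ 2)
        (fun _ _ => sq_nonneg _) (Finset.mem_univ i)).trans (h.sum_sq_sub_weightedMean_le hN n l)
    refine (mul_le_mul_of_nonneg_left h3 (stepCost_nonneg hs _)).trans (le_of_eq ?_)
    unfold stepBound
    ring
  have h4 : 0 ≤ s / 2 * (‖x n i - weightedMean β L (x n)‖ ^ 2 +
      ‖x (n + 1) i - weightedMean β L (x n)‖ ^ 2) := by positivity
  rw [← div_le_iff₀' (by positivity)]
  linarith

/-- Since `stepCost` is at least `s / 2`, summability of the step bounds also forces consensus. -/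
theorem IsTrajectory.norm_sq_sub_le (h : IsTrajectory L β γ η x) (hs : 0 < s) (n : ℕ)
    (i j : Fin N) :
    ‖x n i - x n j‖ ^ 2 ≤ 8 / s * ∑ l, stepBound γ s η (x 0) n l := by
  rw [EuclideanSpace.real_norm_sq_eq, Finset.mul_sum]
  refine Finset.sum_le_sum fun l _ => ?_
  rw [PiLp.sub_apply, h.sub_eq]
  have h1 := le_spread (x 0) l i
  have h2 := le_spread (x 0) l j
  set c := ensembleMean (x 0) l
  have h3 : (x 0 i l - x 0 j l) ^ 2 ≤ 4 * spread (x 0) l := by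
    nlinarith [sq_nonneg ((x 0 i l - c) + (x 0 j l - c))]
  have h4 : s / 2 ≤ stepCost γ s (η n l) := by
    have : 0 ≤ s / 2 * (1 - γ - η n l) ^ 2 + (γ + η n l) ^ 2 / (2 * s) := by positivity
    unfold stepCost
    linarith
  have h5 : 0 ≤ contraction γ η n l ^ 2 * spread (x 0) l :=
    mul_nonneg (sq_nonneg _) (spread_nonneg _ _)
  calc _ = contraction γ η n l ^ 2 * (x 0 i l - x 0 j l) ^ 2 := by ring
    _ ≤ contraction γ η n l ^ 2 * (4 * spread (x 0) l) := by gcongr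
    _ = 8 / s * (contraction γ η n l ^ 2 * spread (x 0) l * (s / 2)) := by field_simp; ring
    _ ≤ 8 / s * (contraction γ η n l ^ 2 * spread (x 0) l * stepCost γ s (η n l)) := by gcongr
    _ = _ := by unfold stepBound; ring

/-- If the step bounds decay geometrically in a summable sense, all particles converge to a
common limit. -/
theorem IsTrajectory.exists_tendsto (h : IsTrajectory L β γ η x) (hs : 0 < s) (hN : 0 < N)
    {θ : ℝ} (hθ0 : 0 < θ) (hθ1 : θ < 1)
    (hsum : Summable fun n => (∑ l, stepBound γ s η (x 0) n l) / θ ^ n) :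
    ∃ z, ∀ i, Tendsto (fun n => x n i) atTop (𝓝 z) := by
  have hgeo := summable_geometric_of_lt_one hθ0.le hθ1
  have hb : ∀ n, 0 ≤ ∑ l, stepBound γ s η (x 0) n l := fun n =>
    Finset.sum_nonneg fun l _ => stepBound_nonneg hs _ _ _
  have hconv : ∀ i, ∃ z, Tendsto (fun n => x n i) atTop (𝓝 z) := by
    intro i
    refine cauchySeq_tendsto_of_complete (cauchySeq_of_summable_dist ?_)
    refine Summable.of_nonneg_of_le (fun _ => dist_nonneg) (fun n => ?_)
      (hgeo.add (hsum.mul_left (2 * s * (2 * N))))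
    have h1 := h.norm_sq_step_le hs hN n i
    rw [dist_comm, dist_eq_norm, Nat.succ_eq_add_one]
    set u := ‖x (n + 1) i - x n i‖ with hu
    have hu0 : 0 ≤ u := norm_nonneg _
    have hθn : 0 < θ ^ n := by positivity
    have h2 : u ^ 2 / θ ^ n ≤ 2 * s * (2 * N) * ((∑ l, stepBound γ s η (x 0) n l) / θ ^ n) := by
      rw [← mul_div_assoc]
      gcongr
      linarith
    refine le_trans ?_ (add_le_add_right h2 _)
    -- Either way `u ≤ θ ^ n + u ^ 2 / θ ^ n`: this turns weighted square summability of the steps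
    -- into summability.
    rcases le_total u (θ ^ n) with hc | hc
    · have : 0 ≤ u ^ 2 / θ ^ n := by positivity
      linarith
    · have : u ≤ u ^ 2 / θ ^ n := by
        rw [le_div_iff₀ hθn]
        nlinarith
      linarith
  choose z hz using hconv
  refine ⟨z ⟨0, hN⟩, fun i => ?_⟩
  have hlim : Tendsto (fun n => ∑ l, stepBound γ s η (x 0) n l) atTop (𝓝 0) := by
    refine squeeze_zero hb (fun n => ?_) hsum.tendsto_atTop_zero
    rw [le_div_iff₀ (by positivity)]
    exact mul_le_of_le_one_right (hb n) (pow_le_one₀ hθ0.le hθ1.le)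
  have hdiff : Tendsto (fun n => ‖x n i - x n ⟨0, hN⟩‖ ^ 2) atTop (𝓝 0) :=
    squeeze_zero (fun _ => sq_nonneg _) (fun n => h.norm_sq_sub_le hs n i _)
      (by simpa using hlim.const_mul (8 / s))
  have hd2 : Tendsto (fun n => ‖x n i - x n ⟨0, hN⟩‖ ^ 2) atTop (𝓝 (‖z i - z ⟨0, hN⟩‖ ^ 2)) :=
    (((hz i).sub (hz _)).norm).pow 2
  have := tendsto_nhds_unique hd2 hdiff
  have hzz : z i = z ⟨0, hN⟩ := by simpa [sub_eq_zero] using this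
  exact hzz ▸ hz i

end Pathwise

/-! ### Expectations under independence. -/

section Independence

variable {Ω : Type*} [MeasurableSpace Ω] {P : Measure Ω}

theorem integrable_prod_range_of_iIndepFun [IsProbabilityMeasure P] {Y : ℕ → Ω → ℝ}
    (hY : iIndepFun Y P) (hm : ∀ k, Measurable (Y k)) (hi : ∀ k, Integrable (Y k) P) (n : ℕ) :
    Integrable (∏ k ∈ Finset.range n, Y k) P ∧
      ∫ ω, (∏ k ∈ Finset.range n, Y k) ω ∂P = ∏ k ∈ Finset.range n, ∫ ω, Y k ω ∂P := by
  induction n with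
  | zero => exact ⟨integrable_const (1 : ℝ), by simp⟩
  | succ n ih =>
    have hind := hY.indepFun_prod_range_succ hm n
    rw [Finset.prod_range_succ, Finset.prod_range_succ, ← ih.2]
    exact ⟨hind.integrable_mul ih.1 (hi n),
      hind.integral_mul_eq_mul_integral ih.1.aestronglyMeasurable (hi n).aestronglyMeasurable⟩

theorem ae_summable_of_summable_integral {f : ℕ → Ω → ℝ} (hf : ∀ n ω, 0 ≤ f n ω)
    (hi : ∀ n, Integrable (f n) P) (hs : Summable fun n => ∫ ω, f n ω ∂P) :
    ∀ᵐ ω ∂P, Summable fun n => f n ω := by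
  have hm : ∀ n, AEMeasurable (fun ω => ENNReal.ofReal (f n ω)) P := fun n =>
    (hi n).aemeasurable.ennreal_ofReal
  have hfin : ∫⁻ ω, ∑' n, ENNReal.ofReal (f n ω) ∂P ≠ ⊤ := by
    rw [lintegral_tsum hm]
    simp_rw [← ofReal_integral_eq_lintegral_ofReal (hi _) (Eventually.of_forall (hf _))]
    exact hs.tsum_ofReal_ne_top
  filter_upwards [ae_lt_top' (AEMeasurable.tsum hm) hfin] with ω hω
  have := ENNReal.summable_toReal hω.ne
  simpa [ENNReal.toReal_ofReal (hf _ _)] using this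

end Independence

section Moments

variable {d N : ℕ} {Ω : Type*} [MeasurableSpace Ω] {P : Measure Ω} [IsProbabilityMeasure P]
  {γ ζ s : ℝ} {η : ℕ → Fin d → Ω → ℝ}

theorem Noise.integrable_sq_affine (hη : Noise P ζ η) (a b : ℝ) (n : ℕ) (l : Fin d) :
    Integrable (fun ω => (a + b * η n l ω) ^ 2) P ∧
      ∫ ω, (a + b * η n l ω) ^ 2 ∂P = a ^ 2 + b ^ 2 * ζ ^ 2 := by
  have h1 : Integrable (fun ω => η n l ω) P := (hη.memLp n l).integrable (by norm_num)
  have h2 : Integrable (fun ω => η n l ω ^ 2) P := (hη.memLp n l).integrable_sq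
  have he : (fun ω => (a + b * η n l ω) ^ 2) =
      fun ω => a ^ 2 + 2 * a * b * η n l ω + b ^ 2 * η n l ω ^ 2 := by
    ext ω; ring
  have h3 : Integrable (fun ω => a ^ 2 + 2 * a * b * η n l ω) P :=
    (integrable_const _).add (h1.const_mul _)
  rw [he]
  refine ⟨h3.add (h2.const_mul _), ?_⟩
  rw [integral_add h3 (h2.const_mul _), integral_add (integrable_const _) (h1.const_mul _),
    integral_const_mul, integral_const_mul, hη.mean, hη.variance]
  simp

theorem Noise.integrable_sq_factor (hη : Noise P ζ η) (n : ℕ) (l : Fin d) :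
    Integrable (fun ω => (1 - γ - η n l ω) ^ 2) P ∧
      ∫ ω, (1 - γ - η n l ω) ^ 2 ∂P = (1 - γ) ^ 2 + ζ ^ 2 := by
  simpa [sub_eq_add_neg] using hη.integrable_sq_affine (1 - γ) (-1) n l

theorem Noise.integrable_stepCost (hη : Noise P ζ η) (n : ℕ) (l : Fin d) :
    Integrable (fun ω => stepCost γ s (η n l ω)) P ∧
      ∫ ω, stepCost γ s (η n l ω) ∂P =
        s / 2 * (1 + ((1 - γ) ^ 2 + ζ ^ 2)) + (γ ^ 2 + ζ ^ 2) / (2 * s) := by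
  obtain ⟨h1, e1⟩ := hη.integrable_sq_factor (γ := γ) n l
  obtain ⟨h2, e2⟩ : Integrable (fun ω => (γ + η n l ω) ^ 2) P ∧
      ∫ ω, (γ + η n l ω) ^ 2 ∂P = γ ^ 2 + ζ ^ 2 := by
    simpa using hη.integrable_sq_affine γ 1 n l
  have h3 : Integrable (fun ω => 1 + (1 - γ - η n l ω) ^ 2) P := (integrable_const _).add h1
  unfold stepCost
  refine ⟨(h3.const_mul _).add (h2.div_const _), ?_⟩
  rw [integral_add (h3.const_mul _) (h2.div_const _), integral_const_mul, integral_div,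
    integral_add (integrable_const _) h1, e1, e2]
  simp

theorem measurable_stepCost : Measurable (stepCost γ s) := by
  unfold stepCost; fun_prop

theorem Noise.integrable_contraction_mul_stepCost (hη : Noise P ζ η) (n : ℕ) (l : Fin d) :
    Integrable (fun ω => contraction γ (fun n l => η n l ω) n l ^ 2 * stepCost γ s (η n l ω)) P ∧
      ∫ ω, contraction γ (fun n l => η n l ω) n l ^ 2 * stepCost γ s (η n l ω) ∂P =
        ((1 - γ) ^ 2 + ζ ^ 2) ^ n *
          (s / 2 * (1 + ((1 - γ) ^ 2 + ζ ^ 2)) + (γ ^ 2 + ζ ^ 2) / (2 * s)) := by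
  -- The cost occupies slot `n` and the squared factors the earlier slots, so a single product of
  -- independent variables covers both.
  set g : ℕ → ℝ → ℝ := fun k => if k = n then stepCost γ s else fun y => (1 - γ - y) ^ 2 with hg
  have hgm : ∀ k, Measurable (g k) := by
    intro k
    by_cases hk : k = n
    · simpa [hg, hk] using measurable_stepCost
    · simp only [hg, hk, if_false]
      fun_prop
  have hind : iIndepFun (fun k ω => g k (η k l ω)) P :=
    (hη.indep.precomp (g := fun k : ℕ => (k, l)) fun a b h => (Prod.ext_iff.1 h).1).comp g hgm
  have hgn : ∀ ω, g n (η n l ω) = stepCost γ s (η n l ω) := fun ω => by simp [hg]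
  have hgk : ∀ k ∈ Finset.range n, ∀ ω, g k (η k l ω) = (1 - γ - η k l ω) ^ 2 := fun k hk ω => by
    simp [hg, (Finset.mem_range.1 hk).ne]
  have hint : ∀ k, Integrable (fun ω => g k (η k l ω)) P := by
    intro k
    by_cases hk : k = n
    · simpa [hg, hk] using (hη.integrable_stepCost n l).1
    · simpa [hg, hk] using (hη.integrable_sq_factor k l).1
  have key := integrable_prod_range_of_iIndepFun hind
    (fun k => (hgm k).comp (hη.measurable k l)) hint (n + 1)
  have hfun : (∏ k ∈ Finset.range (n + 1), fun ω => g k (η k l ω)) =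
      fun ω => contraction γ (fun n l => η n l ω) n l ^ 2 * stepCost γ s (η n l ω) := by
    ext ω
    rw [Finset.prod_apply, Finset.prod_range_succ, hgn, contraction, ← Finset.prod_pow]
    congr 1
    exact Finset.prod_congr rfl fun k hk => hgk k hk ω
  rw [hfun] at key
  refine ⟨key.1, key.2.trans ?_⟩
  rw [Finset.prod_range_succ]
  simp_rw [hgn]
  rw [(hη.integrable_stepCost n l).2]
  congr 1
  rw [Finset.prod_congr rfl fun k hk => by
    simp_rw [hgk k hk]; exact (hη.integrable_sq_factor (γ := γ) k l).2]
  simp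

theorem measurable_spread (l : Fin d) : Measurable fun y : Fin N → Space d => spread y l := by
  unfold spread
  refine Measurable.iSup fun i => ?_
  have : Measurable fun y : Fin N → Space d => ensembleMean y := by
    unfold ensembleMean
    fun_prop
  fun_prop

theorem spread_le_of_norm_le {y : Fin N → Space d} {R : ℝ} (hy : ∀ i, ‖y i‖ ≤ R)
    (l : Fin d) : spread y l ≤ (2 * R) ^ 2 := by
  refine Real.iSup_le (fun i => ?_) (by positivity)
  have hN : 0 < N := i.pos
  have hm : ‖ensembleMean y‖ ≤ R := by
    rw [ensembleMean, norm_smul, norm_inv, Real.norm_natCast, inv_mul_le_iff₀ (by positivity)]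
    refine (norm_sum_le_of_le _ fun j _ => hy j).trans ?_
    simp
  have h1 : |y i l - ensembleMean y l| ≤ 2 * R := by
    have := PiLp.norm_apply_le (y i - ensembleMean y) l
    rw [PiLp.sub_apply, Real.norm_eq_abs] at this
    refine this.trans ((norm_sub_le _ _).trans ?_)
    linarith [hy i]
  exact sq_le_sq' (abs_le.1 h1).1 (abs_le.1 h1).2

variable {Ω₀ : Type*} [MeasurableSpace Ω₀] {P₀ : Measure Ω₀} {Xin : Ω₀ → Space d}
  {f : Space d → ℝ} {Xstar : Space d} {X0 : Fin N → Ω → Space d}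

/-- Compact support of the density makes the initial positions almost surely bounded. -/
theorem InitialData.integrable_spread (hX : InitialData P P₀ Xin η X0)
    (hin : ReferenceLaw P₀ Xin f Xstar) (l : Fin d) :
    Integrable (fun ω => spread (fun i => X0 i ω) l) P := by
  obtain ⟨R, hbd⟩ := hin.exists_ae_norm_le
  have hall : ∀ᵐ ω ∂P, ∀ i, ‖X0 i ω‖ ≤ R := by
    rw [ae_all_iff]
    intro i
    exact (hX.ident i).symm.ae_snd (p := fun x => ‖x‖ ≤ R)
      (measurableSet_le measurable_norm measurable_const) hbd
  refine Integrable.of_bound (C := (2 * R) ^ 2) ?_ ?_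
  · exact ((measurable_spread l).comp (measurable_pi_lambda _ hX.measurable)).aestronglyMeasurable
  · filter_upwards [hall] with ω hω
    rw [Real.norm_of_nonneg (spread_nonneg _ _)]
    exact spread_le_of_norm_le hω l

theorem integrable_stepBound (hη : Noise P ζ η) (hX : InitialData P P₀ Xin η X0)
    (hin : ReferenceLaw P₀ Xin f Xstar) (n : ℕ) (l : Fin d) :
    Integrable (fun ω => stepBound γ s (fun n l => η n l ω) (fun i => X0 i ω) n l) P ∧
      ∫ ω, stepBound γ s (fun n l => η n l ω) (fun i => X0 i ω) n l ∂P =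
        ((1 - γ) ^ 2 + ζ ^ 2) ^ n *
          (s / 2 * (1 + ((1 - γ) ^ 2 + ζ ^ 2)) + (γ ^ 2 + ζ ^ 2) / (2 * s)) *
          ∫ ω, spread (fun i => X0 i ω) l ∂P := by
  obtain ⟨h1, e1⟩ := hη.integrable_contraction_mul_stepCost (γ := γ) (s := s) n l
  have h2 := hX.integrable_spread hin l
  have hm : Measurable fun e : ℕ × Fin d → ℝ =>
      contraction γ (fun n l => e (n, l)) n l ^ 2 * stepCost γ s (e (n, l)) := by
    have := measurable_stepCost (γ := γ) (s := s)
    unfold contraction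
    fun_prop
  have hind : IndepFun
      (fun ω => contraction γ (fun n l => η n l ω) n l ^ 2 * stepCost γ s (η n l ω))
      (fun ω => spread (fun i => X0 i ω) l) P :=
    hX.indep_noise.symm.comp hm (measurable_spread l)
  rw [← e1]
  exact ⟨hind.integrable_mul h1 h2,
    hind.integral_mul_eq_mul_integral h1.aestronglyMeasurable h2.aestronglyMeasurable⟩

end Moments

/-! ### Measurability of the process. -/

section Convergence

variable {d N : ℕ} {Ω : Type*} [MeasurableSpace Ω] {P : Measure Ω}
  {L : Space d → ℝ} {β γ : ℝ} {η : ℕ → Fin d → Ω → ℝ} {X : ℕ → Fin N → Ω → Space d}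

theorem measurable_weightedMean (hL : Measurable L) :
    Measurable fun y : Fin N → Space d => weightedMean β L y := by
  unfold weightedMean
  fun_prop

theorem IsSolution.ae_isTrajectory (h : IsSolution P L β γ η X) :
    ∀ᵐ ω ∂P, IsTrajectory L β γ (fun n l => η n l ω) (fun n i => X n i ω) := h

/-- The recursion holds only almost surely, so measurability passes from time `0` to later times
only up to null sets. -/
theorem IsSolution.aemeasurable (h : IsSolution P L β γ η X) (hL : Measurable L)
    (hη : ∀ n l, Measurable (η n l)) (h0 : ∀ i, Measurable (X 0 i)) (n : ℕ) (i : Fin N) :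
    AEMeasurable (X n i) P := by
  induction n generalizing i with
  | zero => exact (h0 i).aemeasurable
  | succ n ih =>
    have hW : AEMeasurable (fun ω => weightedMean β L (fun j => X n j ω)) P :=
      (measurable_weightedMean hL).comp_aemeasurable (aemeasurable_pi_lambda _ ih)
    have hstep : AEMeasurable (fun ω => X n i ω - γ • (X n i ω - weightedMean β L (fun j => X n j ω))
        - ∑ l, ((X n i ω l - weightedMean β L (fun j => X n j ω) l) * η n l ω) •
            (EuclideanSpace.single l 1 : Space d)) P := by
      have hXi := ih i
      refine (hXi.sub ((hXi.sub hW).const_smul γ)).sub ?_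
      refine Finset.aemeasurable_fun_sum _ fun l _ => ?_
      have hcoord : Measurable fun y : Space d => y l := by fun_prop
      exact (((hcoord.comp_aemeasurable hXi).sub (hcoord.comp_aemeasurable hW)).mul
        (hη n l).aemeasurable).smul_const _
    refine hstep.congr ?_
    filter_upwards [h] with ω hω
    exact (hω n i).symm

end Convergence

/-! ### Almost sure consensus and the quality of the limit. -/

section Consensus

variable {d N : ℕ} {L : Space d → ℝ} {Xstar : Space d}
  {Ω₀ : Type*} [MeasurableSpace Ω₀] {P₀ : Measure Ω₀} {Xin : Ω₀ → Space d} {f : Space d → ℝ}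
  {Ω : Type*} [MeasurableSpace Ω] {P : Measure Ω} [IsProbabilityMeasure P]
  {β γ ζ : ℝ} {η : ℕ → Fin d → Ω → ℝ} {X : ℕ → Fin N → Ω → Space d}

/-- All particles converge almost surely to a common random point. -/
theorem exists_consensus (hL : Measurable L) (hin : ReferenceLaw P₀ Xin f Xstar) (hN : 0 < N)
    (hγζ : (γ - 1) ^ 2 + ζ ^ 2 < 1) (hη : Noise P ζ η) (hX0 : InitialData P P₀ Xin η (X 0))
    (hX : IsSolution P L β γ η X) :
    ∃ Xinf : Ω → Space d, Measurable Xinf ∧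
      ∀ i, ∀ᵐ ω ∂P, Tendsto (fun n => X n i ω) atTop (𝓝 (Xinf ω)) := by
  set ρ := (1 - γ) ^ 2 + ζ ^ 2 with hρ
  have hρ0 : 0 ≤ ρ := by positivity
  have hρ1 : ρ < 1 := by rw [hρ]; nlinarith
  -- Any `θ` strictly between `ρ` and `1` works: the expected step bounds divided by `θ ^ n` remain
  -- geometric. The Young weight is irrelevant here and is set to `1`.
  obtain ⟨θ, hθ⟩ : ∃ θ, θ = (1 + ρ) / 2 := ⟨_, rfl⟩
  have hθ0 : 0 < θ := by rw [hθ]; positivity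
  have hθ1 : θ < 1 := by rw [hθ]; linarith
  have hρθ : ρ / θ < 1 := by rw [div_lt_one hθ0, hθ]; linarith
  set κ : ℝ := 1 / 2 * (1 + ρ) + (γ ^ 2 + ζ ^ 2) / (2 * 1) with hκ
  set M : ℝ := ∑ l, ∫ ω, spread (fun i => X 0 i ω) l ∂P with hM
  have hb := fun n l => integrable_stepBound (γ := γ) (s := 1) hη hX0 hin n l
  have hi : ∀ n, Integrable (fun ω =>
      (∑ l, stepBound γ 1 (fun n l => η n l ω) (fun i => X 0 i ω) n l) / θ ^ n) P := fun n =>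
    (integrable_finsetSum _ fun l _ => (hb n l).1).div_const _
  have he : ∀ n, ∫ ω,
      (∑ l, stepBound γ 1 (fun n l => η n l ω) (fun i => X 0 i ω) n l) / θ ^ n ∂P =
      (ρ / θ) ^ n * (κ * M) := by
    intro n
    rw [integral_div, integral_finsetSum _ fun l _ => (hb n l).1,
      Finset.sum_congr rfl fun l _ => (hb n l).2, ← Finset.mul_sum, div_pow, ← hρ,
      ← hκ, ← hM]
    ring
  have hsum := ae_summable_of_summable_integral
    (fun n ω => div_nonneg (Finset.sum_nonneg fun l _ => stepBound_nonneg one_pos _ _ _)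
      (pow_nonneg hθ0.le n)) hi
    (by
      simp_rw [he]
      exact (summable_geometric_of_lt_one (by positivity) hρθ).mul_right _)
  have hlim : ∀ᵐ ω ∂P, ∃ z, ∀ i, Tendsto (fun n => X n i ω) atTop (𝓝 z) := by
    filter_upwards [hsum, hX.ae_isTrajectory] with ω h1 h2
    exact h2.exists_tendsto one_pos hN hθ0 hθ1 h1
  have hmeas := hX.aemeasurable hL hη.measurable hX0.measurable
  obtain ⟨Z, hZm, hZ⟩ := measurable_limit_of_tendsto_metrizable_ae
    (fun n => hmeas n ⟨0, hN⟩) (hlim.mono fun ω h => h.imp fun z hz => hz ⟨0, hN⟩)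
  refine ⟨Z, hZm, fun i => ?_⟩
  filter_upwards [hlim, hZ] with ω ⟨z, hz⟩ h2
  exact tendsto_nhds_unique (hz _) h2 ▸ hz i

/-- Lower bound for the Laplace functional of the consensus point. -/
theorem integral_exp_consensus_ge (hL : Objective L Xstar) (hin : ReferenceLaw P₀ Xin f Xstar)
    (hβ : 0 < β) (hN : 0 < N) (hγζ : (γ - 1) ^ 2 + ζ ^ 2 < 1) (hη : Noise P ζ η)
    (hX0 : InitialData P P₀ Xin η (X 0)) (hX : IsSolution P L β γ η X) {Xinf : Ω → Space d}
    (hlim : ∀ i, ∀ᵐ ω ∂P, Tendsto (fun n => X n i ω) atTop (𝓝 (Xinf ω))) :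
    ∫ ω, Real.exp (-β * L (Xin ω)) ∂P₀ -
        2 * hessianBound L * √((1 + (1 - γ) ^ 2 + ζ ^ 2) * (γ ^ 2 + ζ ^ 2)) * β *
          Real.exp (-β * minValue L) / (1 - ((1 - γ) ^ 2 + ζ ^ 2)) * initialSpread P (X 0) ≤
      ∫ ω, Real.exp (-β * L (Xinf ω)) ∂P := by
  set ρ := (1 - γ) ^ 2 + ζ ^ 2 with hρ
  set q := γ ^ 2 + ζ ^ 2 with hq
  have hρ0 : 0 ≤ ρ := by positivity
  have hρ1 : ρ < 1 := by rw [hρ]; nlinarith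
  -- `γ = 0` is excluded by `hγζ`.
  have hq0 : 0 < q := by
    rcases eq_or_ne γ 0 with h0 | h0
    · rw [h0] at hγζ
      nlinarith [sq_nonneg ζ]
    · rw [hq]; positivity
  -- The minimizer over `s` of the expected cost `s / 2 * (1 + ρ) + q / (2 * s)`, with minimal value
  -- `√((1 + ρ) * q)`.
  set s := √q / √(1 + ρ) with hs
  have hsq : √q ^ 2 = q := Real.sq_sqrt hq0.le
  have hsr : √(1 + ρ) ^ 2 = 1 + ρ := Real.sq_sqrt (by positivity)
  have hsq0 : 0 < √q := Real.sqrt_pos.2 hq0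
  have hsr0 : 0 < √(1 + ρ) := Real.sqrt_pos.2 (by positivity)
  have hs0 : 0 < s := by rw [hs]; positivity
  have hκ : s / 2 * (1 + ρ) + q / (2 * s) = √((1 + (1 - γ) ^ 2 + ζ ^ 2) * q) := by
    rw [add_assoc 1, ← hρ, Real.sqrt_mul (by positivity), hs]
    nth_rewrite 2 [← hsr]
    nth_rewrite 2 [← hsq]
    field_simp
    ring
  set κ := √((1 + (1 - γ) ^ 2 + ζ ^ 2) * q) with hκdef
  have hκ0 : 0 ≤ κ := Real.sqrt_nonneg _
  set M := initialSpread P (X 0) with hM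
  have hMeq : M = ∑ l, ∫ ω, spread (fun i => X 0 i ω) l ∂P := rfl
  have hM0 : 0 ≤ M := by
    rw [hMeq]
    exact Finset.sum_nonneg fun l _ => integral_nonneg fun ω => spread_nonneg _ _
  have hm : ∀ x, minValue L ≤ L x := fun x => hL.minValue_eq ▸ hL.le x
  have hC : 0 ≤ hessianBound L := hessianBound_nonneg
  have hLc := hL.contDiff.continuous
  have hexpc : Continuous fun x => Real.exp (-β * L x) := by fun_prop
  have hmeas := hX.aemeasurable hLc.measurable hη.measurable hX0.measurable
  have hexp1 : ∀ x, ‖Real.exp (-β * L x)‖ ≤ 1 := by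
    intro x
    rw [Real.norm_of_nonneg (Real.exp_pos _).le, Real.exp_le_one_iff]
    nlinarith [mul_pos hβ (hL.min_pos.trans_le (hm x))]
  have hiexp : ∀ n i, Integrable (fun ω => Real.exp (-β * L (X n i ω))) P := fun n i =>
    Integrable.of_bound (C := 1)
      (hexpc.measurable.comp_aemeasurable (hmeas n i)).aestronglyMeasurable
      (Eventually.of_forall fun ω => hexp1 _)
  set S : ℕ → Ω → ℝ := fun n ω => (N : ℝ)⁻¹ * ∑ i, Real.exp (-β * L (X n i ω)) with hS
  have hiS : ∀ n, Integrable (S n) P := fun n =>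
    (integrable_finsetSum _ fun i _ => hiexp n i).const_mul _
  have hN' : (N : ℝ) ≠ 0 := by positivity
  have hS0 : ∫ ω, S 0 ω ∂P = ∫ ω, Real.exp (-β * L (Xin ω)) ∂P₀ := by
    have hid : ∀ i, ∫ ω, Real.exp (-β * L (X 0 i ω)) ∂P = ∫ ω, Real.exp (-β * L (Xin ω)) ∂P₀ :=
      fun i => ((hX0.ident i).comp hexpc.measurable).integral_eq
    rw [hS, integral_const_mul, integral_finsetSum _ fun i _ => hiexp 0 i]
    rw [Finset.sum_congr rfl fun i _ => hid i]
    simp [hN']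
  set A := 2 * β * hessianBound L * Real.exp (-β * minValue L) with hA
  have hA0 : 0 ≤ A := by positivity
  have hb := fun n l => integrable_stepBound (γ := γ) (s := s) hη hX0 hin n l
  have hstep : ∀ n, ∫ ω, S n ω ∂P - A * κ * M * ρ ^ n ≤ ∫ ω, S (n + 1) ω ∂P := by
    intro n
    have hB : Integrable (fun ω => A *
        ∑ l, stepBound γ s (fun n l => η n l ω) (fun i => X 0 i ω) n l) P :=
      (integrable_finsetSum _ fun l _ => (hb n l).1).const_mul _
    have hle : ∫ ω, (S n ω - S (n + 1) ω) ∂P ≤ ∫ ω, A *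
        ∑ l, stepBound γ s (fun n l => η n l ω) (fun i => X 0 i ω) n l ∂P := by
      refine integral_mono_ae ((hiS n).sub (hiS (n + 1))) hB ?_
      filter_upwards [hX.ae_isTrajectory] with ω hω
      exact hω.mean_exp_sub_le hL.contDiff hL.hessian_bdd hm hβ hs0 hN n
    rw [integral_sub (hiS n) (hiS (n + 1)), integral_const_mul A,
      integral_finsetSum _ fun l _ => (hb n l).1, Finset.sum_congr rfl fun l _ => (hb n l).2,
      ← Finset.mul_sum, ← hMeq, ← hρ, ← hq, hκ] at hle
    linarith
  have htotal : ∀ n, ∫ ω, S 0 ω ∂P - A * κ * M * ∑ k ∈ Finset.range n, ρ ^ k ≤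
      ∫ ω, S n ω ∂P := by
    intro n
    induction n with
    | zero => simp
    | succ n ih =>
      rw [Finset.sum_range_succ]
      linarith [hstep n]
  have hgeo : ∀ n, ∑ k ∈ Finset.range n, ρ ^ k ≤ (1 - ρ)⁻¹ := fun n =>
    (tsum_geometric_of_lt_one hρ0 hρ1) ▸
      (summable_geometric_of_lt_one hρ0 hρ1).sum_le_tsum _ fun k _ => pow_nonneg hρ0 k
  have hlow : ∀ n, ∫ ω, S 0 ω ∂P - A * κ * M * (1 - ρ)⁻¹ ≤ ∫ ω, S n ω ∂P := by
    intro n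
    refine le_trans ?_ (htotal n)
    gcongr
    exact hgeo n
  have hconv : Tendsto (fun n => ∫ ω, S n ω ∂P) atTop
      (𝓝 (∫ ω, Real.exp (-β * L (Xinf ω)) ∂P)) := by
    refine tendsto_integral_of_dominated_convergence (fun _ => 1)
      (fun n => (hiS n).aestronglyMeasurable) (integrable_const _) (fun n => ?_) ?_
    · refine Eventually.of_forall fun ω => ?_
      rw [hS, norm_mul, norm_inv, Real.norm_natCast, inv_mul_le_iff₀ (by positivity)]
      refine (norm_sum_le_of_le _ fun i _ => hexp1 (X n i ω)).trans ?_
      simp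
    · filter_upwards [ae_all_iff.2 hlim] with ω hω
      have h1 : Tendsto (fun n => ∑ i, Real.exp (-β * L (X n i ω))) atTop
          (𝓝 (∑ _i : Fin N, Real.exp (-β * L (Xinf ω)))) :=
        tendsto_finsetSum _ fun i _ => (hexpc.tendsto _).comp (hω i)
      have h2 := h1.const_mul (N : ℝ)⁻¹
      simpa [hS, hN'] using h2
  rw [← hS0]
  refine le_trans (le_of_eq ?_) (ge_of_tendsto' hconv hlow)
  rw [hA]
  ring

/-- Any almost sure lower bound `a` of `g` gives `c ≤ exp (-β a)`, and the essential infimum is the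
supremum of such `a`. The bound `m` keeps this set nonempty, as a real supremum requires. -/
theorem essInf_bounds_of_le_integral_exp {g : Ω → ℝ} {m c : ℝ} (hβ : 0 < β) (hm : ∀ ω, m ≤ g ω)
    (hc : 0 < c) (h : c ≤ ∫ ω, Real.exp (-β * g ω) ∂P) :
    m ≤ essInf g P ∧ essInf g P ≤ -(1 / β) * Real.log c := by
  have hmem : m ∈ {a | ∀ᵐ ω ∂P, a ≤ g ω} := by
    rw [Set.mem_ofPred_eq]
    exact Eventually.of_forall hm
  have hub : ∀ a ∈ {a | ∀ᵐ ω ∂P, a ≤ g ω}, a ≤ -(1 / β) * Real.log c := by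
    intro a ha
    rw [Set.mem_ofPred_eq] at ha
    have h1 : ∫ ω, Real.exp (-β * g ω) ∂P ≤ Real.exp (-β * a) := by
      calc _ ≤ ∫ _ω, Real.exp (-β * a) ∂P := by
            refine integral_mono_of_nonneg (Eventually.of_forall fun ω => (Real.exp_pos _).le)
              (integrable_const _) ?_
            filter_upwards [ha] with ω hω
            rw [Real.exp_le_exp]
            nlinarith
        _ = _ := by simp
    have h2 := Real.log_le_log hc (h.trans h1)
    rw [Real.log_exp] at h2
    have h3 : a = -(1 / β) * (-β * a) := by field_simp
    rw [h3]
    exact mul_le_mul_of_nonpos_left h2 (by simpa using hβ.le)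
  rw [essInf, liminf_eq]
  exact ⟨le_csSup ⟨_, hub⟩ hmem, csSup_le ⟨m, hmem⟩ hub⟩

end Consensus

end CBO

end

/-! ### The main theorem. -/

theorem theorem3p2 {d : ℕ} (L : CBO.Space d → ℝ) (Xstar : CBO.Space d)
    (hL : CBO.Objective L Xstar)
    {Ω₀ : Type*} [MeasurableSpace Ω₀] (P₀ : Measure Ω₀) [IsProbabilityMeasure P₀]
    (Xin : Ω₀ → CBO.Space d) (f : CBO.Space d → ℝ)
    (hXin : CBO.ReferenceLaw P₀ Xin f Xstar)
    (ε : ℝ) (hε₀ : 0 < ε) (hε₁ : ε < 1) :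
    ∃ E : ℝ → ℝ,
      E =O[atTop] (fun β : ℝ => 1 / β) ∧
      (∀ β : ℝ, 0 < β →
        -(1 / β) * Real.log (∫ ω, Real.exp (-β * L (Xin ω)) ∂P₀) - (1 / β) * Real.log ε
          = L Xstar + (d : ℝ) / 2 * (Real.log β / β) + E β) ∧
      ∀ (β γ ζ : ℝ) (N : ℕ) (Ω : Type*) [MeasurableSpace Ω] (P : Measure Ω)
        [IsProbabilityMeasure P] (η : ℕ → Fin d → Ω → ℝ) (X : ℕ → Fin N → Ω → CBO.Space d),
        0 < β → 0 < N → (γ - 1) ^ 2 + ζ ^ 2 < 1 →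
        CBO.Noise P ζ η →
        CBO.InitialData P P₀ Xin η (X 0) →
        CBO.IsSolution P L β γ η X →
        (1 - ε) * ∫ ω, Real.exp (-β * L (Xin ω)) ∂P₀ ≥
          2 * CBO.hessianBound L * √((1 + (1 - γ) ^ 2 + ζ ^ 2) * (γ ^ 2 + ζ ^ 2)) * β *
              Real.exp (-β * CBO.minValue L) / (1 - Real.exp (-(1 - (γ - 1) ^ 2 - ζ ^ 2))) *
            CBO.initialSpread P (X 0) →
        ∃ Xinf : Ω → CBO.Space d, Measurable Xinf ∧
          (∀ i, ∀ᵐ ω ∂P, Tendsto (fun n => X n i ω) atTop (𝓝 (Xinf ω))) ∧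
          essInf (fun ω => L (Xinf ω)) P ≤
            -(1 / β) * Real.log (∫ ω, Real.exp (-β * L (Xin ω)) ∂P₀)
              - (1 / β) * Real.log ε ∧
          |essInf (fun ω => L (Xinf ω)) P - L Xstar| ≤
            (d : ℝ) / 2 * (Real.log β / β) + E β := by
  -- `E` is defined as the defect in the expansion, so the identity is immediate and only the order
  -- of `E` needs Laplace's method.
  refine ⟨fun β => -(1 / β) * Real.log (∫ ω, Real.exp (-β * L (Xin ω)) ∂P₀)
      - (1 / β) * Real.log ε - L Xstar - (d : ℝ) / 2 * (Real.log β / β),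
    CBO.laplace_isBigO hL hXin ε, fun β _ => by ring, ?_⟩
  intro β γ ζ N Ω _ P _ η X hβ hN hγζ hη hX0 hX hcond
  obtain ⟨Xinf, hmeas, hlim⟩ :=
    CBO.exists_consensus hL.contDiff.continuous.measurable hXin hN hγζ hη hX0 hX
  have hge := CBO.integral_exp_consensus_ge hL hXin hβ hN hγζ hη hX0 hX hlim
  set I := ∫ ω, Real.exp (-β * L (Xin ω)) ∂P₀ with hI
  have hLc := hL.contDiff.continuous
  have hIpos : 0 < I := by
    refine integral_exp_pos (Integrable.of_bound (C := 1) ?_ (Eventually.of_forall fun ω => ?_))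
    · exact ((by fun_prop : Continuous fun x => Real.exp (-β * L x)).measurable.comp
        hXin.measurable_var).aestronglyMeasurable
    · rw [Real.norm_of_nonneg (Real.exp_pos _).le, Real.exp_le_one_iff]
      nlinarith [mul_pos hβ (hL.min_pos.trans_le (hL.minValue_eq ▸ hL.le (Xin ω)))]
  have hC : 0 ≤ CBO.hessianBound L := CBO.hessianBound_nonneg
  have hspread : 0 ≤ CBO.initialSpread P (X 0) :=
    Finset.sum_nonneg fun l _ => integral_nonneg fun ω => CBO.spread_nonneg (fun i => X 0 i ω) l
  -- As `1 - exp (-t) ≤ t` with `t = 1 - ρ`, the assumed bound implies the one with the denominator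
  -- `1 - ρ` of the geometric series.
  have hden : 1 - Real.exp (-(1 - (γ - 1) ^ 2 - ζ ^ 2)) ≤ 1 - ((1 - γ) ^ 2 + ζ ^ 2) := by
    nlinarith [Real.add_one_le_exp (-(1 - (γ - 1) ^ 2 - ζ ^ 2))]
  have hden0 : 0 < 1 - Real.exp (-(1 - (γ - 1) ^ 2 - ζ ^ 2)) := by
    rw [sub_pos, Real.exp_lt_one_iff]
    linarith
  have hε : ε * I ≤ ∫ ω, Real.exp (-β * L (Xinf ω)) ∂P := by
    have : 2 * CBO.hessianBound L * √((1 + (1 - γ) ^ 2 + ζ ^ 2) * (γ ^ 2 + ζ ^ 2)) * β *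
        Real.exp (-β * CBO.minValue L) / (1 - ((1 - γ) ^ 2 + ζ ^ 2)) *
          CBO.initialSpread P (X 0) ≤
        2 * CBO.hessianBound L * √((1 + (1 - γ) ^ 2 + ζ ^ 2) * (γ ^ 2 + ζ ^ 2)) * β *
        Real.exp (-β * CBO.minValue L) / (1 - Real.exp (-(1 - (γ - 1) ^ 2 - ζ ^ 2))) *
          CBO.initialSpread P (X 0) := by gcongr
    linarith
  obtain ⟨hlow, hup⟩ := CBO.essInf_bounds_of_le_integral_exp (g := fun ω => L (Xinf ω)) hβ
    (fun ω => hL.le (Xinf ω)) (mul_pos hε₀ hIpos) hε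
  rw [Real.log_mul hε₀.ne' hIpos.ne'] at hup
  refine ⟨Xinf, hmeas, hlim, by linarith, ?_⟩
  -- Since `L Xstar` is the minimum, the difference is nonnegative and the upper bound alone
  -- suffices.
  rw [abs_of_nonneg (sub_nonneg.2 hlow)]
  linarith
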